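/- Let $\Omega\subset\mathbb R^n$ be a bounded open set with $C^2$ boundary, and let $d\in C^2(\overline\Omega)$ be positive in $\Omega$ and equal to the distance to $\partial\Omega$ in a neighbourhood $\{x\in\overline\Omega:\operatorname{dist}(x,\partial\Omega)\le\varepsilon_0\}$ of the boundary, for some $\varepsilon_0>0$. Let $1<q\le 2$, $q'=\frac{q}{q-1}$, $0\le\widetilde q<1$ and $C_0>0$. Let $\mathcal P_{q'}$ be the set of Borel probability measures $\nu$ on $\overline\Omega\times\mathbb R^n$ with $\Lambda_{q'}(\nu):=\left(\int|\alpha|^{q'}\,d\nu(x,\alpha)\right)^{1/q'}<\infty$, with the weak-$*$ topology. Let $H:\mathbb R^n\times\mathcal P_{q'}\to\mathbb R$ and set $L(\alpha,\mu)=\sup_{p}\{-\alpha\cdot p-H(p,\mu)\}$. Assume: (i) $H$ is differentiable and strictly convex in $p$, and $H$ and $D_pH$ are continuous on $\mathbb R^n\times\mathcal P_{q'}$; (ii) $\big|H(p,\mu)-f_1(\mu)|p+f_2(\mu)|^q\big|\le(|p|^{\widetilde q}+1)f_3(\mu)$ for all $(p,\mu)$, where $f_1>0$, $f_2$ (with values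 in $\mathbb R^n$) and $f_3\ge0$ are functions on $\mathcal P_{q'}$ that send sets on which $\Lambda_{q'}$ is bounded into compact subsets of $(0,\infty)$, $\mathbb R^n$ and $[0,\infty)$, respectively; (iii) $L$ is strictly convex in $\alpha$; (iv) $\int_{\Omega\times\mathbb R^n}(L(\alpha,\mu_1)-L(\alpha,\mu_2))\,d(\mu_1-\mu_2)(x,\alpha)\ge0$ for all $\mu_1,\mu_2\in\mathcal P_{q'}$ carried by $\Omega\times\mathbb R^n$; (v) $L(\alpha,\mu)\ge\frac1{C_0}|\alpha|^{q'}-C_0\left(1+\Lambda_{q'}(\mu)^{q'}\right)$ for all $(\alpha,\mu)$; (vi) $|L(\alpha,\mu)|\le C_0\left(1+|\alpha|^{q'}+\Lambda_{q'}(\mu)^{q'}\right)$ for all $(\alpha,\mu)$. Let $p\in C^0(\Omega;\mathbb R^n)$ satisfy $\lim_{d(x)\to0}|p(x)|^{q-1}d(x)=\gamma$ for some $\gamma>0$, and let $m$ be a Borel probability measure on $\Omega$ with $\int_\Omega d^{-q'}\,dm<\infty$. For $\mu\in\mathcal P_{q'}$ consider the fixed-point relation $$\mu=(I,-D_pH(p(\cdot),\mu))\#m.\qquad(*)$$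 Then $p\in L^q(m)$, and: 1) every $\mu\in\mathcal P_{q'}$ satisfying $(*)$ satisfies $$\Lambda_{q'}(\mu)^{q'}\le 4C_0^2+\frac{(q')^{q-1}(2C_0)^q}{q}\,\|p\|_{L^q(m)}^q;$$ 2) there is at most one $\mu\in\mathcal P_{q'}$ satisfying $(*)$; 3) there exists a unique $\mu\in\mathcal P_{q'}$ satisfying $(*)$. -/

import Mathlib

open MeasureTheory Filter Topology Set
open scoped ENNReal

noncomputable section

/-- Points of `ℝⁿ` with the Euclidean norm. -/
abbrev Rn (n : ℕ) : Type := EuclideanSpace ℝ (Fin n)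

/-- The boundary of `Ω` is `C²`-smooth: near every boundary point, `Ω` is the sublevel set
`{φ < 0}` of a `C²` function `φ` whose differential does not vanish at that point. -/
def HasC2Boundary {n : ℕ} (Ω : Set (Rn n)) : Prop :=
  ∀ x ∈ frontier Ω, ∃ (U : Set (Rn n)) (φ : Rn n → ℝ),
    IsOpen U ∧ x ∈ U ∧ ContDiffOn ℝ 2 φ U ∧ fderiv ℝ φ x ≠ 0 ∧
      Ω ∩ U = {y | y ∈ U ∧ φ y < 0}

/-- `d ∈ C²(closure Ω)` is positive in `Ω` and equals the distance to the boundary at the points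
of `closure Ω` whose distance to the boundary is at most some `ε₀ > 0`. -/
structure IsRegularizedDistance {n : ℕ} (Ω : Set (Rn n)) (d : Rn n → ℝ) : Prop where
  contDiffOn : ContDiffOn ℝ 2 d (closure Ω)
  pos : ∀ x ∈ Ω, 0 < d x
  eq_dist : ∃ ε₀ : ℝ, 0 < ε₀ ∧ ∀ x ∈ closure Ω,
    Metric.infDist x (frontier Ω) ≤ ε₀ → d x = Metric.infDist x (frontier Ω)

/-- The space `closure Ω × ℝⁿ` of pairs (state, control). -/
abbrev StateControl {n : ℕ} (Ω : Set (Rn n)) : Type := ↥(closure Ω) × Rn n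

/-- `(∫ |α|^r dν(x,α))^(1/r)`, as an extended nonnegative number (used for `1 ≤ r < ∞`). -/
def controlMoment {n : ℕ} {Ω : Set (Rn n)} (r : ℝ) (ν : Measure (StateControl Ω)) : ℝ≥0∞ :=
  (∫⁻ z, ‖z.2‖ₑ ^ r ∂ν) ^ (1 / r)

/-- `𝒫_r(closure Ω × ℝⁿ)`: the Borel probability measures on `closure Ω × ℝⁿ` with finite `r`-th
moment in the control.  As a subtype of `ProbabilityMeasure` it carries the topology of weak
convergence of measures; on probability measures on the locally compact, second countable metric
space `closure Ω × ℝⁿ` this is the weak-* topology induced by the continuous functions that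
vanish at infinity. -/
abbrev MomentMeasure {n : ℕ} (Ω : Set (Rn n)) (r : ℝ) : Type :=
  {ν : ProbabilityMeasure (StateControl Ω) //
    controlMoment r (ν : Measure (StateControl Ω)) < ∞}

/-- `Λ_r(ν)` as a real number, for `ν ∈ 𝒫_r(closure Ω × ℝⁿ)`. -/
def Lam {n : ℕ} {Ω : Set (Rn n)} {r : ℝ} (ν : MomentMeasure Ω r) : ℝ :=
  (controlMoment r (ν.1 : Measure (StateControl Ω))).toReal

/-- The derivative `D_p H(p, μ)`, as a vector. -/
def DpH {n : ℕ} {P : Type} (H : Rn n → P → ℝ) (p : Rn n) (μ : P) : Rn n :=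
  gradient (fun p' => H p' μ) p

/-- The Lagrangian `L(α, μ) = sup_p (-α · p - H(p, μ))`. -/
def Lagr {n : ℕ} {P : Type} (H : Rn n → P → ℝ) (α : Rn n) (μ : P) : ℝ :=
  ⨆ p : Rn n, (-(inner ℝ α p) - H p μ)

/-- `H` is differentiable and strictly convex in `p`, and `H` and `D_p H` are jointly
continuous. -/
structure HamiltonianRegular {n : ℕ} {Ω : Set (Rn n)} {r : ℝ}
    (H : Rn n → MomentMeasure Ω r → ℝ) : Prop where
  differentiable : ∀ μ, Differentiable ℝ (fun p => H p μ)
  strictConvex : ∀ μ, StrictConvexOn ℝ univ (fun p => H p μ)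
  continuous_H : Continuous (fun z : Rn n × MomentMeasure Ω r => H z.1 z.2)
  continuous_DpH : Continuous (fun z : Rn n × MomentMeasure Ω r => DpH H z.1 z.2)

/-- `f` sends every set that is bounded with respect to `Λ_r` into a compact subset of `A`. -/
def MapsBoundedToCompact {n : ℕ} {Ω : Set (Rn n)} {r : ℝ} {Y : Type} [TopologicalSpace Y]
    (f : MomentMeasure Ω r → Y) (A : Set Y) : Prop :=
  ∀ S : Set (MomentMeasure Ω r), (∃ R : ℝ, ∀ ν ∈ S, Lam ν ≤ R) →
    ∃ K : Set Y, IsCompact K ∧ K ⊆ A ∧ MapsTo f S K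

/-- `|H(p,μ) - f₁(μ)|p + f₂(μ)|^q| ≤ (|p|^s + 1) f₃(μ)`, where `f₁ > 0`, `f₂`, `f₃ ≥ 0` send
`Λ`-bounded sets into compact subsets of `(0,∞)`, `ℝⁿ`, `[0,∞)`. -/
structure HamiltonianGrowth {n : ℕ} {Ω : Set (Rn n)} {r : ℝ}
    (H : Rn n → MomentMeasure Ω r → ℝ) (q s : ℝ)
    (f₁ : MomentMeasure Ω r → ℝ) (f₂ : MomentMeasure Ω r → Rn n)
    (f₃ : MomentMeasure Ω r → ℝ) : Prop where
  f₁_pos : ∀ μ, 0 < f₁ μ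
  f₃_nonneg : ∀ μ, 0 ≤ f₃ μ
  f₁_compact : MapsBoundedToCompact f₁ (Ioi 0)
  f₂_compact : MapsBoundedToCompact f₂ univ
  f₃_compact : MapsBoundedToCompact f₃ (Ici 0)
  bound : ∀ p μ, |H p μ - f₁ μ * ‖p + f₂ μ‖ ^ q| ≤ (‖p‖ ^ s + 1) * f₃ μ

/-- The Lagrangian is strictly convex in the control. -/
def LagrangianStrictConvex {n : ℕ} {Ω : Set (Rn n)} {r : ℝ}
    (H : Rn n → MomentMeasure Ω r → ℝ) : Prop :=
  ∀ μ, StrictConvexOn ℝ univ (fun α => Lagr H α μ)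

/-- Lasry-Lions monotonicity `∫_{Ω × ℝⁿ} (L(α,μ₁) - L(α,μ₂)) d(μ₁ - μ₂)(x,α) ≥ 0`.  It is only
required of measures carried by `Ω × ℝⁿ`, for which the integrals over `Ω × ℝⁿ` and over
`closure Ω × ℝⁿ` agree. -/
def LagrangianMonotone {n : ℕ} {Ω : Set (Rn n)} {r : ℝ}
    (H : Rn n → MomentMeasure Ω r → ℝ) : Prop :=
  ∀ μ₁ μ₂ : MomentMeasure Ω r,
    (∀ᵐ z ∂(μ₁.1 : Measure (StateControl Ω)), (z.1 : Rn n) ∈ Ω) →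
    (∀ᵐ z ∂(μ₂.1 : Measure (StateControl Ω)), (z.1 : Rn n) ∈ Ω) →
    0 ≤ (∫ z, (Lagr H z.2 μ₁ - Lagr H z.2 μ₂) ∂(μ₁.1 : Measure (StateControl Ω)))
      - ∫ z, (Lagr H z.2 μ₁ - Lagr H z.2 μ₂) ∂(μ₂.1 : Measure (StateControl Ω))

/-- `L(α,μ) ≥ |α|^r / C₀ - C₀ (1 + Λ_r(μ)^r)`. -/
def LagrangianLowerBound {n : ℕ} {Ω : Set (Rn n)} {r : ℝ}
    (H : Rn n → MomentMeasure Ω r → ℝ) (C₀ : ℝ) : Prop :=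
  ∀ α μ, 1 / C₀ * ‖α‖ ^ r - C₀ * (1 + Lam μ ^ r) ≤ Lagr H α μ

/-- `|L(α,μ)| ≤ C₀ (1 + |α|^r + Λ_r(μ)^r)`. -/
def LagrangianBound {n : ℕ} {Ω : Set (Rn n)} {r : ℝ}
    (H : Rn n → MomentMeasure Ω r → ℝ) (C₀ : ℝ) : Prop :=
  ∀ α μ, |Lagr H α μ| ≤ C₀ * (1 + ‖α‖ ^ r + Lam μ ^ r)

/-- The push-forward `(I, a) # m`, a measure on `closure Ω × ℝⁿ`, of a measure `m` on `Ω`. -/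
def graphLaw {n : ℕ} {Ω : Set (Rn n)} (m : Measure Ω) (a : Ω → Rn n) :
    Measure (StateControl Ω) :=
  m.map (fun x => (inclusion subset_closure x, a x))

/-- The fixed-point relation `μ = (I, -D_p H(p(·), μ)) # m`. -/
def IsFixedPointLaw {n : ℕ} {Ω : Set (Rn n)} {r : ℝ} (H : Rn n → MomentMeasure Ω r → ℝ)
    (p : Ω → Rn n) (m : Measure Ω) (μ : MomentMeasure Ω r) : Prop :=
  (μ.1 : Measure (StateControl Ω)) = graphLaw m (fun x => -DpH H (p x) μ)

end

/-! Write r for q'. The unknown is really a control a in L^r(m), whose law is μ_a = (I, a)#m. By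
Legendre duality, μ_a is a fixed point exactly when a(x) minimises α ↦ L(α, μ_a) + α·p(x) for almost
every x: the relation is the equilibrium condition of a game whose costs are monotone in the law.

Testing monotonicity on two laws of controls bounds the crossed costs ∫L(a, μ_b) + ∫L(b, μ_a) by the
uncrossed ones. For two fixed points this forces equality in Fenchel's inequality almost everywhere,
hence uniqueness. With b = 0 it shows that a fixed point beats the zero control against the law of
the zero control, and coercivity with Young's inequality gives the moment bound.

Existence needs no topological fixed-point theorem. The function `gap` b a = ∫(L(a, μ_b) - L(b, μ_b)
+ (a - b)·p) is convex in a, and monotone as a bifunction. Sion's theorem and weak compactness in L²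
yield a with `gap` b a ≤ 0 for every b in a closed convex bounded set of controls, and Minty's
segment argument reverses this to `gap` a b ≥ 0. The set consists of the controls dominated
pointwise by some k in L^r(m). Testing b = 0 bounds the moment of μ_a independently of k, so k can
be chosen beforehand to dominate every feedback to a law with that moment bound. The feedback to μ_a
is then an admissible b, and `gap` a b ≥ 0 says that a coincides with it. -/

section Hilbert

/-! ### Weak compactness of closed convex bounded sets. -/

variable {E : Type*} [NormedAddCommGroup E] [InnerProductSpace ℝ E] [CompleteSpace E]

/-- The Riesz identification of a real Hilbert space with its weak dual. -/
noncomputable def rieszWeak (E : Type*) [NormedAddCommGroup E] [InnerProductSpace ℝ E]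
    [CompleteSpace E] (a : E) : WeakDual ℝ E :=
  StrongDual.toWeakDual (InnerProductSpace.toDual ℝ E a)

theorem rieszWeak_apply (a v : E) : rieszWeak E a v = inner ℝ a v := rfl

theorem rieszWeak_bijective : Function.Bijective (rieszWeak E) :=
  StrongDual.toWeakDual.bijective.comp (InnerProductSpace.toDual ℝ E).bijective

/-- Closed convex subsets of a Hilbert space are weakly closed. -/
theorem isClosed_image_rieszWeak {C : Set E} (hC : Convex ℝ C) (hcl : IsClosed C) :
    IsClosed (rieszWeak E '' C) := by
  rw [← isOpen_compl_iff, isOpen_iff_mem_nhds]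
  intro ψ hψ
  obtain ⟨y, rfl⟩ := rieszWeak_bijective.2 ψ
  have hy : y ∉ C := fun h => hψ ⟨y, h, rfl⟩
  obtain ⟨f, u, hu, hf⟩ := geometric_hahn_banach_point_closed hC hcl hy
  have hfv : ∀ z, f z = inner ℝ z ((InnerProductSpace.toDual ℝ E).symm f) := fun z => by
    rw [real_inner_comm, InnerProductSpace.toDual_symm_apply]
  have hopen : IsOpen {φ : WeakDual ℝ E | φ ((InnerProductSpace.toDual ℝ E).symm f) < u} :=
    isOpen_Iio.preimage (WeakBilin.eval_continuous _ _)
  refine mem_of_superset (hopen.mem_nhds ?_) ?_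
  · change rieszWeak E y _ < u
    rw [rieszWeak_apply, ← hfv]
    exact hu
  · rintro φ hφ ⟨c, hc, rfl⟩
    have h1 : rieszWeak E c ((InnerProductSpace.toDual ℝ E).symm f) < u := hφ
    rw [rieszWeak_apply, ← hfv] at h1
    exact lt_asymm h1 (hf c hc)

/-- A family of closed convex subsets of a closed convex bounded set of a Hilbert space with the
finite intersection property has nonempty intersection. -/
theorem nonempty_iInter_of_closed_convex {ι : Type*} {K : Set E} (hK : Convex ℝ K)
    (hKcl : IsClosed K) (hKb : Bornology.IsBounded K) (Z : ι → Set E)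
    (hZ : ∀ i, Convex ℝ (Z i)) (hZcl : ∀ i, IsClosed (Z i))
    (hfin : ∀ s : Finset ι, (K ∩ ⋂ i ∈ s, Z i).Nonempty) : (K ∩ ⋂ i, Z i).Nonempty := by
  have hcomp : IsCompact (rieszWeak E '' K) := by
    obtain ⟨R, hR⟩ := hKb.subset_closedBall 0
    refine (WeakDual.isCompact_closedBall (𝕜 := ℝ) (E := E) 0 R).of_isClosed_subset
      (isClosed_image_rieszWeak hK hKcl) ?_
    rintro _ ⟨a, ha, rfl⟩
    have h1 : ‖a‖ ≤ R := by simpa using hR ha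
    change InnerProductSpace.toDual ℝ E a ∈ Metric.closedBall 0 R
    simpa using h1
  obtain ⟨ψ, hψK, hψ⟩ := hcomp.inter_iInter_nonempty (fun i => rieszWeak E '' Z i)
    (fun i => isClosed_image_rieszWeak (hZ i) (hZcl i)) (fun s => by
      obtain ⟨a, haK, ha⟩ := hfin s
      refine ⟨rieszWeak E a, ⟨a, haK, rfl⟩, ?_⟩
      simp only [mem_iInter] at ha ⊢
      exact fun i hi => ⟨a, ha i hi, rfl⟩)
  obtain ⟨a, haK, rfl⟩ := hψK
  refine ⟨a, haK, mem_iInter.2 fun i => ?_⟩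
  obtain ⟨c, hc, hca⟩ := mem_iInter.1 hψ i
  rwa [← rieszWeak_bijective.1 hca]

end Hilbert

/-! ### Monotone equilibrium problems. -/

section Minimax

variable {E : Type*} [NormedAddCommGroup E] [NormedSpace ℝ E]

/-- The finite-dimensional step of the equilibrium problem: finitely many inequalities of a
monotone bifunction have a common solution. -/
theorem exists_finite_equilibrium {K : Set E} (hK : Convex ℝ K) (F : E → E → ℝ)
    (hconv : ∀ b ∈ K, ConvexOn ℝ K (F b)) (hcont : ∀ b ∈ K, ContinuousOn (F b) K)
    (hmono : ∀ a ∈ K, ∀ b ∈ K, F a b + F b a ≤ 0)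
    {ι : Type*} [Fintype ι] [Nonempty ι] (b : ι → E) (hb : ∀ i, b i ∈ K) :
    ∃ a ∈ K, ∀ i, F (b i) a ≤ 0 := by
  classical
  set X : Set E := convexHull ℝ (range b) with hX
  have hXK : X ⊆ K := convexHull_min (range_subset_iff.2 hb) hK
  have hXc : Convex ℝ X := convex_convexHull ℝ _
  set f : E → (ι → ℝ) → ℝ := fun a w => ∑ i, w i * F (b i) a with hf
  obtain ⟨a, ha, w, hw, hsad⟩ := Sion.exists_isSaddlePointOn (X := X) (Y := stdSimplex ℝ ι) (f := f)
    ⟨b (Classical.arbitrary ι), subset_convexHull ℝ _ (mem_range_self _)⟩ hXc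
    ((finite_range b).isCompact_convexHull (𝕜 := ℝ))
    (fun w _ => ContinuousOn.lowerSemicontinuousOn
      (continuousOn_finsetSum _ fun i _ =>
        continuousOn_const.mul ((hcont (b i) (hb i)).mono hXK)))
    (fun w hw => by
      refine ConvexOn.quasiconvexOn ⟨hXc, fun x hx y hy s t hs ht hst => ?_⟩
      simp only [hf, smul_eq_mul, Finset.mul_sum, ← Finset.sum_add_distrib]
      refine Finset.sum_le_sum fun i _ => ?_
      have := (hconv (b i) (hb i)).2 (hXK hx) (hXK hy) hs ht hst
      simp only [smul_eq_mul] at this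
      nlinarith [mul_le_mul_of_nonneg_left this (hw.1 i)])
    (convex_stdSimplex ℝ ι)
    ⟨_, single_mem_stdSimplex ℝ (Classical.arbitrary ι)⟩ (isCompact_stdSimplex ℝ ι)
    (fun x _ => (Continuous.continuousOn (by fun_prop)).upperSemicontinuousOn)
    (fun x _ => by
      refine ConcaveOn.quasiconcaveOn ⟨convex_stdSimplex ℝ ι, fun u _ v _ s t _ _ _ => ?_⟩
      simp only [hf, smul_eq_mul, Finset.mul_sum, ← Finset.sum_add_distrib, Pi.add_apply,
        Pi.smul_apply]
      exact Finset.sum_le_sum fun i _ => by linarith)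
  refine ⟨a, hXK ha, fun i => ?_⟩
  -- The barycentre of the `b j` with the optimal weights `w` is the test point: convexity bounds
  -- the saddle value by a double sum that monotonicity makes nonpositive after symmetrisation.
  have hxX : ∑ j, w j • b j ∈ X :=
    hXc.sum_mem (fun j _ => hw.1 j) hw.2
      (fun j _ => subset_convexHull ℝ _ (mem_range_self _))
  have h1 := hsad _ hxX _ (single_mem_stdSimplex ℝ i)
  have h2 : f a (Pi.single i 1) = F (b i) a := by
    simp [hf, Pi.single_apply]
  have h3 : f (∑ j, w j • b j) w ≤ ∑ i, ∑ j, w i * w j * F (b i) (b j) := by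
    refine Finset.sum_le_sum fun i _ => ?_
    have := (hconv (b i) (hb i)).map_sum_le (t := Finset.univ) (w := w) (p := b)
      (fun j _ => hw.1 j) hw.2 (fun j _ => hb j)
    simp only [smul_eq_mul] at this
    calc w i * F (b i) (∑ j, w j • b j) ≤ w i * ∑ j, w j * F (b i) (b j) :=
          mul_le_mul_of_nonneg_left this (hw.1 i)
      _ = _ := by rw [Finset.mul_sum]; exact Finset.sum_congr rfl fun j _ => by ring
  have h4 : ∑ i, ∑ j, w i * w j * F (b i) (b j) = ∑ i, ∑ j, w i * w j * F (b j) (b i) := by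
    rw [Finset.sum_comm]
    exact Finset.sum_congr rfl fun i _ => Finset.sum_congr rfl fun j _ => by ring
  have h5 : ∑ i, ∑ j, w i * w j * F (b i) (b j) + ∑ i, ∑ j, w i * w j * F (b j) (b i) ≤ 0 := by
    rw [← Finset.sum_add_distrib]
    refine Finset.sum_nonpos fun i _ => ?_
    rw [← Finset.sum_add_distrib]
    refine Finset.sum_nonpos fun j _ => ?_
    rw [← mul_add]
    exact mul_nonpos_of_nonneg_of_nonpos (mul_nonneg (hw.1 i) (hw.1 j))
      (hmono _ (hb i) _ (hb j))
  rw [← h2]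
  linarith

end Minimax

/-- A monotone bifunction on a closed convex bounded set of a Hilbert space, convex and continuous
in its second variable, admits a solution of the Minty equilibrium problem. -/
theorem exists_minty_equilibrium {E : Type*} [NormedAddCommGroup E] [InnerProductSpace ℝ E]
    [CompleteSpace E] {K : Set E} (hKne : K.Nonempty) (hK : Convex ℝ K) (hKcl : IsClosed K)
    (hKb : Bornology.IsBounded K) (F : E → E → ℝ)
    (hconv : ∀ b ∈ K, ConvexOn ℝ K (F b)) (hcont : ∀ b ∈ K, ContinuousOn (F b) K)
    (hmono : ∀ a ∈ K, ∀ b ∈ K, F a b + F b a ≤ 0) :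
    ∃ a ∈ K, ∀ b ∈ K, F b a ≤ 0 := by
  obtain ⟨a, haK, ha⟩ := nonempty_iInter_of_closed_convex hK hKcl hKb
    (fun b : K => {a | a ∈ K ∧ F b a ≤ 0}) (fun b => (hconv b b.2).convex_le 0)
    (fun b => (hcont b b.2).preimage_isClosed_of_isClosed hKcl isClosed_Iic) (fun s => by
      rcases s.eq_empty_or_nonempty with rfl | hs
      · simpa using hKne
      · have : Nonempty s := hs.to_subtype
        obtain ⟨a, haK, ha⟩ := exists_finite_equilibrium hK F hconv hcont hmono
          (fun i : s => ((i : K) : E)) (fun i => i.1.2)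
        refine ⟨a, haK, ?_⟩
        simp only [mem_iInter]
        exact fun i hi => ⟨haK, ha ⟨i, hi⟩⟩)
  exact ⟨a, haK, fun b hb => (mem_iInter.1 ha ⟨b, hb⟩).2⟩

/-! ### Convexity and Legendre duality. -/

/-- A differentiable convex function lies above its tangent planes. -/
theorem ConvexOn.gradient_le {E : Type*} [NormedAddCommGroup E] [InnerProductSpace ℝ E]
    [CompleteSpace E] {f : E → ℝ} (hf : ConvexOn ℝ univ f) {x : E} (hx : DifferentiableAt ℝ f x)
    (y : E) : f x + inner ℝ (gradient f x) (y - x) ≤ f y := by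
  have hg : ConvexOn ℝ univ (fun t : ℝ => f (AffineMap.lineMap x y t)) := by
    have := hf.comp_affineMap (AffineMap.lineMap x y : ℝ →ᵃ[ℝ] E)
    rwa [preimage_univ] at this
  have hder : HasDerivAt (fun t : ℝ => f (AffineMap.lineMap x y t))
      (inner ℝ (gradient f x) (y - x)) 0 := by
    have h1 : HasFDerivAt f (InnerProductSpace.toDual ℝ E (gradient f x))
        (AffineMap.lineMap x y (0 : ℝ)) := by
      simpa using hx.hasGradientAt.hasFDerivAt
    have h2 : HasDerivAt (AffineMap.lineMap x y : ℝ → E) (y - x) 0 := AffineMap.hasDerivAt_lineMap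
    exact h1.comp_hasDerivAt (0 : ℝ) h2
  have := hg.le_slope_of_hasDerivAt (mem_univ 0) (mem_univ 1) zero_lt_one hder
  rw [slope_def_field, AffineMap.lineMap_apply_zero, AffineMap.lineMap_apply_one, sub_zero,
    div_one] at this
  linarith

/-- Beyond the threshold (A / c)^(1 / (q - 1)) the power dominates the linear term; below it the
linear term is bounded. -/
theorem exists_forall_mul_sub_rpow_le {A c q : ℝ} (hA : 0 ≤ A) (hc : 0 < c) (hq : 1 < q) :
    ∃ B : ℝ, ∀ t : ℝ, 0 ≤ t → A * t - c * t ^ q ≤ B := by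
  refine ⟨A * (A / c) ^ (1 / (q - 1)), fun t ht => ?_⟩
  have hq1 : 0 < q - 1 := by linarith
  have hAc : 0 ≤ A / c := by positivity
  rcases le_total t ((A / c) ^ (1 / (q - 1))) with h | h
  · have h1 : 0 ≤ c * t ^ q := by positivity
    nlinarith [mul_le_mul_of_nonneg_left h hA]
  · have h1 : A / c ≤ t ^ (q - 1) := by
      calc A / c = ((A / c) ^ (1 / (q - 1))) ^ (q - 1) := by
            rw [← Real.rpow_mul hAc, one_div_mul_cancel hq1.ne', Real.rpow_one]
        _ ≤ _ := Real.rpow_le_rpow (by positivity) h hq1.le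
    have h2 : t ^ q = t ^ (q - 1) * t := by
      rw [← Real.rpow_add_one' ht (by linarith)]; ring_nf
    have h3 : A ≤ c * t ^ (q - 1) := by rwa [div_le_iff₀' hc] at h1
    have h4 : 0 ≤ A * (A / c) ^ (1 / (q - 1)) := by positivity
    rw [h2]
    nlinarith [mul_le_mul_of_nonneg_right h3 ht]

section Legendre

variable {n : ℕ} {P : Type} {H : Rn n → P → ℝ}

/-- The functions whose supremum defines the Lagrangian are bounded above. -/
def LagrBdd (H : Rn n → P → ℝ) : Prop :=
  ∀ α μ, BddAbove (range fun p : Rn n => -(inner ℝ α p) - H p μ)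

theorem LagrBdd.fenchel (hb : LagrBdd H) (α p : Rn n) (μ : P) :
    -(inner ℝ α p) - H p μ ≤ Lagr H α μ :=
  le_ciSup (hb α μ) p

/-- The tangent inequality for `H` at `p` says that `p` realises the supremum. -/
theorem Lagr_neg_DpH (hconv : ∀ μ, ConvexOn ℝ univ fun p => H p μ)
    (hdiff : ∀ μ, Differentiable ℝ fun p => H p μ) (hb : LagrBdd H) (p : Rn n) (μ : P) :
    Lagr H (-DpH H p μ) μ = -(inner ℝ (-DpH H p μ) p) - H p μ := by
  refine le_antisymm (ciSup_le fun p' => ?_) (hb.fenchel _ _ _)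
  have := (hconv μ).gradient_le (hdiff μ p) p'
  simp only [inner_sub_right, inner_neg_left, DpH] at *
  linarith

/-- Equality in Fenchel's inequality makes `p` a minimum of H(·, μ) + α·, where the derivative
vanishes. -/
theorem eq_neg_DpH_of_Lagr_le (hdiff : ∀ μ, Differentiable ℝ fun p => H p μ) (hb : LagrBdd H)
    {α p : Rn n} {μ : P} (h : Lagr H α μ ≤ -(inner ℝ α p) - H p μ) : α = -DpH H p μ := by
  have hmin : IsMinOn (fun p' => H p' μ + inner ℝ α p') univ p := fun p' _ => by
    have := hb.fenchel α p' μ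
    simp only [mem_ofPred_eq]
    linarith
  have h1 : HasFDerivAt (fun p' => H p' μ + inner ℝ α p')
      (InnerProductSpace.toDual ℝ _ (DpH H p μ) + innerSL ℝ α) p :=
    (hdiff μ p).hasGradientAt.hasFDerivAt.add (innerSL ℝ α).hasFDerivAt
  have h2 := (hmin.isLocalMin univ_mem).hasFDerivAt_eq_zero h1
  have h3 : DpH H p μ + α = 0 := by
    refine ext_inner_right ℝ fun v => ?_
    have := DFunLike.congr_fun h2 v
    simpa [inner_add_left] using this
  exact eq_neg_of_add_eq_zero_right h3

end Legendre

/-! ### Growth of the Hamiltonian and continuity of the Lagrangian. -/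

section Growth

variable {n : ℕ} {Ω : Set (Rn n)} {r : ℝ} {H : Rn n → MomentMeasure Ω r → ℝ}

/-- The term of order q > 1 absorbs the linear term and the error of order s < 1. This boundedness
makes the real supremum in `Lagr` a genuine one rather than the default value 0. -/
theorem HamiltonianGrowth.lagrBdd {q s : ℝ} {f₁ f₃ : MomentMeasure Ω r → ℝ}
    {f₂ : MomentMeasure Ω r → Rn n} (hH : HamiltonianGrowth H q s f₁ f₂ f₃) (hq : 1 < q)
    (hs : 0 ≤ s) (hs1 : s < 1) : LagrBdd H := by
  intro α μ
  have h3 := hH.f₃_nonneg μ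
  obtain ⟨B, hB⟩ := exists_forall_mul_sub_rpow_le (A := ‖α‖ + f₃ μ) (by positivity)
    (hH.f₁_pos μ) hq
  refine ⟨B + (‖α‖ + f₃ μ) * ‖f₂ μ‖ + 2 * f₃ μ, ?_⟩
  rintro _ ⟨p, rfl⟩
  have h1 := (abs_le.1 (hH.bound p μ)).1
  have h2 := hB ‖p + f₂ μ‖ (norm_nonneg _)
  have h4 : ‖p‖ ^ s ≤ 1 + ‖p‖ := by
    rcases le_total ‖p‖ 1 with h | h
    · linarith [Real.rpow_le_one (norm_nonneg p) h hs, norm_nonneg p]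
    · have := Real.rpow_le_rpow_of_exponent_le h hs1.le
      rw [Real.rpow_one] at this
      linarith
  have h5 : ‖p‖ ≤ ‖p + f₂ μ‖ + ‖f₂ μ‖ := by
    simpa using norm_sub_le (p + f₂ μ) (f₂ μ)
  have h6 : -(inner ℝ α p) ≤ ‖α‖ * ‖p‖ :=
    (neg_le_abs _).trans (abs_real_inner_le_norm α p)
  have h7 := mul_le_mul_of_nonneg_right h4 h3
  have h8 := mul_le_mul_of_nonneg_left h5 (by positivity : 0 ≤ ‖α‖ + f₃ μ)
  dsimp only
  nlinarith

theorem Lam_nonneg (μ : MomentMeasure Ω r) : 0 ≤ Lam μ := ENNReal.toReal_nonneg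

/-- Fenchel's inequality against the control of length `A` opposite to `p`: the Hamiltonian grows
faster than any linear function, uniformly on moment-bounded sets. -/
theorem LagrangianBound.le_hamiltonian {C₀ : ℝ} (hC₀ : 0 < C₀) (hr : 0 ≤ r)
    (hL : LagrangianBound H C₀) (hb : LagrBdd H) {A : ℝ} (hA : 0 ≤ A) (p : Rn n)
    (μ : MomentMeasure Ω r) : A * ‖p‖ - C₀ * (1 + A ^ r + Lam μ ^ r) ≤ H p μ := by
  set α : Rn n := -((A / ‖p‖) • p) with hα
  have h1 := hb.fenchel α p μ
  have h2 : -(inner ℝ α p) = A * ‖p‖ := by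
    rw [hα, inner_neg_left, neg_neg, real_inner_smul_left, real_inner_self_eq_norm_sq]
    rcases eq_or_ne ‖p‖ 0 with h | h
    · simp [h]
    · field_simp
  have h3 : ‖α‖ ≤ A := by
    rw [hα, norm_neg, norm_smul, norm_div, norm_norm, Real.norm_of_nonneg hA]
    rcases eq_or_ne ‖p‖ 0 with h | h
    · simpa [h]
    · rw [div_mul_cancel₀ _ h]
  have h4 := (abs_le.1 (hL α μ)).2
  have h5 : ‖α‖ ^ r ≤ A ^ r := Real.rpow_le_rpow (norm_nonneg _) h3 hr
  have h6 : C₀ * (1 + ‖α‖ ^ r + Lam μ ^ r) ≤ C₀ * (1 + A ^ r + Lam μ ^ r) := by gcongr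
  linarith

/-- Localising the supremum to a fixed ball turns joint continuity of `H` into continuity of `Lagr`,
by compactness. -/
theorem exists_Lagr_eq_sSup_closedBall {C₀ : ℝ} (hC₀ : 0 < C₀) (hr : 0 ≤ r)
    (hL : LagrangianBound H C₀) (hb : LagrBdd H) {A : ℝ} (hA : 0 ≤ A) (R : ℝ) :
    ∃ P : ℝ, ∀ α : Rn n, ∀ μ : MomentMeasure Ω r, ‖α‖ ≤ A → Lam μ ≤ R →
      Lagr H α μ =
        sSup ((fun p : Rn n => -(inner ℝ α p) - H p μ) '' Metric.closedBall 0 P) := by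
  set C := C₀ * (1 + (A + 1) ^ r + R ^ r)
  -- If `p` comes within 1 of the supremum, growth of `H` with slope `A + 1` against α·p of slope at
  -- most `A` forces ‖p‖ ≤ 2C + 1. The absolute value keeps the ball nonempty.
  refine ⟨|C + C + 1|, fun α μ hα hμ => ?_⟩
  have hR : Lam μ ^ r ≤ R ^ r := Real.rpow_le_rpow (Lam_nonneg μ) hμ hr
  have hαr : ‖α‖ ^ r ≤ (A + 1) ^ r := Real.rpow_le_rpow (norm_nonneg _) (by linarith) hr
  have hne : ((fun p : Rn n => -(inner ℝ α p) - H p μ) ''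
      Metric.closedBall 0 |C + C + 1|).Nonempty :=
    (Metric.nonempty_closedBall.2 (abs_nonneg _)).image _
  refine le_antisymm ?_ (csSup_le_csSup (hb α μ) hne (image_subset_range _ _))
  by_contra! hlt
  obtain ⟨p, hp⟩ := exists_lt_of_lt_ciSup (max_lt hlt (sub_one_lt (Lagr H α μ)))
  have hp1 := (le_max_left _ _).trans_lt hp
  have hp2 := (le_max_right _ _).trans_lt hp
  have h1 := hL.le_hamiltonian hC₀ hr hb (by linarith : 0 ≤ A + 1) p μ
  have h2 := (abs_le.1 (hL α μ)).1
  have h3 : -(inner ℝ α p) ≤ A * ‖p‖ :=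
    ((neg_le_abs _).trans (abs_real_inner_le_norm α p)).trans (by gcongr)
  have h4 : C₀ * (1 + (A + 1) ^ r + Lam μ ^ r) ≤ C := by simp only [C]; gcongr
  have h5 : C₀ * (1 + ‖α‖ ^ r + Lam μ ^ r) ≤ C := by simp only [C]; gcongr
  refine hp1.not_ge (le_csSup ((hb α μ).mono (image_subset_range _ _)) ⟨p, ?_, rfl⟩)
  rw [mem_closedBall_zero_iff]
  refine le_trans ?_ (le_abs_self _)
  linarith

/-- The Lagrangian is jointly continuous along moment-bounded families. -/
theorem tendsto_Lagr {C₀ : ℝ} (hC₀ : 0 < C₀) (hr : 0 ≤ r)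
    (hL : LagrangianBound H C₀) (hb : LagrBdd H)
    (hH : Continuous fun z : Rn n × MomentMeasure Ω r => H z.1 z.2)
    {ι : Type*} {l : Filter ι} {α : ι → Rn n} {μ : ι → MomentMeasure Ω r} {α₀ : Rn n}
    {μ₀ : MomentMeasure Ω r} (hα : Tendsto α l (𝓝 α₀)) (hμ : Tendsto μ l (𝓝 μ₀)) {R : ℝ}
    (hR : ∀ i, Lam (μ i) ≤ R) :
    Tendsto (fun i => Lagr H (α i) (μ i)) l (𝓝 (Lagr H α₀ μ₀)) := by
  -- The moment of the limit is put into the bound explicitly, so weak lower semicontinuity of `Lam`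
  -- is not needed.
  obtain ⟨P, hP⟩ := exists_Lagr_eq_sSup_closedBall hC₀ hr hL hb
    (by positivity : 0 ≤ ‖α₀‖ + 1) (max R (Lam μ₀))
  have hcont : Continuous fun z : Rn n × MomentMeasure Ω r =>
      sSup ((fun p : Rn n => -(inner ℝ z.1 p) - H p z.2) '' Metric.closedBall 0 P) := by
    refine (isCompact_closedBall (0 : Rn n) P).continuous_sSup
      (f := fun (z : Rn n × MomentMeasure Ω r) (p : Rn n) => -(inner ℝ z.1 p) - H p z.2) ?_
    have h2 : Continuous fun w : (Rn n × MomentMeasure Ω r) × Rn n => H w.2 w.1.2 :=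
      hH.comp (continuous_snd.prodMk (continuous_snd.comp continuous_fst))
    exact (((continuous_fst.comp continuous_fst).inner continuous_snd).neg).sub h2
  rw [hP α₀ μ₀ (by linarith) (le_max_right _ _)]
  refine Tendsto.congr' ?_ ((hcont.tendsto (α₀, μ₀)).comp (hα.prodMk_nhds hμ))
  filter_upwards [hα.norm.eventually_le_const (lt_add_one ‖α₀‖)] with i hi
  exact (hP _ _ hi ((hR i).trans (le_max_left _ _))).symm

theorem LagrangianStrictConvex.continuous (hL : LagrangianStrictConvex H)
    (μ : MomentMeasure Ω r) : Continuous fun α => Lagr H α μ :=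
  (hL μ).convexOn.locallyLipschitz.continuous

end Growth

/-! ### Controls in L^r and their laws. -/

theorem memLp_ofReal_iff_integrable_rpow {X E : Type*} [MeasurableSpace X] {m : Measure X}
    [NormedAddCommGroup E] {r : ℝ} (hr : 0 < r) {a : X → E} (ha : AEStronglyMeasurable a m) :
    MemLp a (ENNReal.ofReal r) m ↔ Integrable (fun x => ‖a x‖ ^ r) m := by
  rw [← integrable_norm_rpow_iff ha (by simpa using hr) ENNReal.ofReal_ne_top,
    ENNReal.toReal_ofReal hr.le]

theorem MeasureTheory.MemLp.integrable_rpow {X E : Type*} [MeasurableSpace X] {m : Measure X}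
    [NormedAddCommGroup E] {r : ℝ} (hr : 0 < r) {a : X → E}
    (ha : MemLp a (ENNReal.ofReal r) m) : Integrable (fun x => ‖a x‖ ^ r) m :=
  (memLp_ofReal_iff_integrable_rpow hr ha.1).1 ha

theorem MeasureTheory.MemLp.toReal_eLpNorm_rpow {X E : Type*} [MeasurableSpace X] {m : Measure X}
    [NormedAddCommGroup E] {r : ℝ} (hr : 0 < r) {a : X → E}
    (ha : MemLp a (ENNReal.ofReal r) m) :
    (eLpNorm a (ENNReal.ofReal r) m).toReal ^ r = ∫ x, ‖a x‖ ^ r ∂m := by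
  have h0 : 0 ≤ ∫ x, ‖a x‖ ^ r ∂m := integral_nonneg fun x => by positivity
  rw [ha.eLpNorm_eq_integral_rpow_norm (by simpa using hr) ENNReal.ofReal_ne_top,
    ENNReal.toReal_ofReal hr.le, ENNReal.toReal_ofReal (by positivity), ← Real.rpow_mul h0,
    inv_mul_cancel₀ hr.ne', Real.rpow_one]

section GraphLaw

variable {n : ℕ} {Ω : Set (Rn n)} {r : ℝ}

theorem measurable_inclusion_closure :
    Measurable (inclusion subset_closure : Ω → closure Ω) :=
  (continuous_inclusion subset_closure).measurable

theorem aemeasurable_graph {m : Measure Ω} {a : Ω → Rn n} (ha : AEMeasurable a m) :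
    AEMeasurable (fun x => ((inclusion subset_closure x : closure Ω), a x)) m :=
  measurable_inclusion_closure.aemeasurable.prodMk ha

theorem controlMoment_graphLaw (hr : 0 < r) {m : Measure Ω} {a : Ω → Rn n}
    (ha : AEMeasurable a m) :
    controlMoment r (graphLaw m a) = eLpNorm a (ENNReal.ofReal r) m := by
  rw [controlMoment, graphLaw, lintegral_map' (by fun_prop) (aemeasurable_graph ha),
    eLpNorm_eq_lintegral_rpow_enorm_toReal (by simpa using hr) ENNReal.ofReal_ne_top,
    ENNReal.toReal_ofReal hr.le]

open Classical in
/-- The law `(I, a) # m` of a control `a ∈ Lʳ(m)`, as a measure with finite moment; the control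
is replaced by `0` when it is not in `Lʳ(m)`. -/
noncomputable def controlLaw (hr : 0 < r) (m : ProbabilityMeasure Ω) (a : Ω → Rn n) :
    MomentMeasure Ω r :=
  have ha : MemLp (if MemLp a (ENNReal.ofReal r) (m : Measure Ω) then a else 0)
      (ENNReal.ofReal r) (m : Measure Ω) := by
    split_ifs with h
    · exact h
    · exact MemLp.zero
  ⟨⟨graphLaw (m : Measure Ω) (if MemLp a (ENNReal.ofReal r) (m : Measure Ω) then a else 0),
    Measure.isProbabilityMeasure_map (aemeasurable_graph ha.1.aemeasurable)⟩,
    (controlMoment_graphLaw hr ha.1.aemeasurable).trans_lt ha.2⟩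

variable {m : ProbabilityMeasure Ω} {a b : Ω → Rn n} (hr : 0 < r)

theorem coe_controlLaw (ha : MemLp a (ENNReal.ofReal r) (m : Measure Ω)) :
    ((controlLaw hr m a).1 : Measure (StateControl Ω)) = graphLaw (m : Measure Ω) a := by
  change graphLaw _ _ = _
  rw [if_pos ha]

theorem Lam_controlLaw_rpow (ha : MemLp a (ENNReal.ofReal r) (m : Measure Ω)) :
    Lam (controlLaw hr m a) ^ r = ∫ x, ‖a x‖ ^ r ∂(m : Measure Ω) := by
  rw [Lam, coe_controlLaw hr ha, controlMoment_graphLaw hr ha.1.aemeasurable,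
    ha.toReal_eLpNorm_rpow hr]

theorem integral_controlLaw (ha : MemLp a (ENNReal.ofReal r) (m : Measure Ω))
    {g : Rn n → ℝ} (hg : Continuous g) :
    ∫ z, g z.2 ∂((controlLaw hr m a).1 : Measure (StateControl Ω)) =
      ∫ x, g (a x) ∂(m : Measure Ω) := by
  rw [coe_controlLaw hr ha, graphLaw]
  exact integral_map (aemeasurable_graph ha.1.aemeasurable)
    (hg.comp continuous_snd).aestronglyMeasurable

theorem ae_mem_controlLaw (hΩ : MeasurableSet Ω)
    (ha : MemLp a (ENNReal.ofReal r) (m : Measure Ω)) :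
    ∀ᵐ z ∂((controlLaw hr m a).1 : Measure (StateControl Ω)), (z.1 : Rn n) ∈ Ω := by
  rw [coe_controlLaw hr ha, graphLaw]
  exact (ae_map_iff (aemeasurable_graph ha.1.aemeasurable)
    (hΩ.preimage (measurable_subtype_coe.comp measurable_fst))).2
    (Eventually.of_forall fun x => x.2)

theorem graphLaw_congr {m : Measure Ω} (h : a =ᵐ[m] b) : graphLaw m a = graphLaw m b := by
  refine Measure.map_congr ?_
  filter_upwards [h] with x hx
  rw [hx]

theorem controlLaw_congr (h : a =ᵐ[(m : Measure Ω)] b) :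
    controlLaw hr m a = controlLaw hr m b := by
  refine Subtype.ext (Subtype.ext ?_)
  change graphLaw _ _ = graphLaw _ _
  rw [memLp_congr_ae h]
  split_ifs
  · exact graphLaw_congr h
  · rfl

/-- Dominated convergence: a bounded continuous test function is dominated by its sup norm, so
almost everywhere convergence of controls suffices. -/
theorem tendsto_controlLaw {ι : Type*} {l : Filter ι} [l.IsCountablyGenerated]
    {u : ι → Ω → Rn n} (hu : ∀ i, MemLp (u i) (ENNReal.ofReal r) (m : Measure Ω))
    (ha : MemLp a (ENNReal.ofReal r) (m : Measure Ω))
    (h : ∀ᵐ x ∂(m : Measure Ω), Tendsto (fun i => u i x) l (𝓝 (a x))) :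
    Tendsto (fun i => controlLaw hr m (u i)) l (𝓝 (controlLaw hr m a)) := by
  rw [tendsto_subtype_rng, ProbabilityMeasure.tendsto_iff_forall_integral_tendsto]
  intro f
  have key : ∀ v : Ω → Rn n, MemLp v (ENNReal.ofReal r) (m : Measure Ω) →
      ∫ z, f z ∂((controlLaw hr m v).1 : Measure (StateControl Ω)) =
        ∫ x, f (inclusion subset_closure x, v x) ∂(m : Measure Ω) := fun v hv => by
    rw [coe_controlLaw hr hv, graphLaw, integral_map (aemeasurable_graph hv.1.aemeasurable)
      f.continuous.aestronglyMeasurable]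
  simp_rw [key _ ha, key _ (hu _)]
  refine tendsto_integral_filter_of_dominated_convergence (fun _ => ‖f‖)
    (Eventually.of_forall fun i => ?_)
    (Eventually.of_forall fun i => Eventually.of_forall fun x => f.norm_coe_le_norm _)
    (integrable_const _) ?_
  · exact (f.continuous.measurable.comp_aemeasurable
      (aemeasurable_graph (hu i).1.aemeasurable)).aestronglyMeasurable
  · filter_upwards [h] with x hx
    exact (f.continuous.tendsto _).comp (tendsto_const_nhds.prodMk_nhds hx)

end GraphLaw

/-! ### Integrability of the momentum up to the boundary. -/

section Distance

variable {n : ℕ} {Ω : Set (Rn n)} {d : Rn n → ℝ}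

/-- On the boundary `d` equals the distance, hence vanishes, so the superlevel set taken in the
closure stays inside `Ω`. -/
theorem IsRegularizedDistance.isCompact_le (hd : IsRegularizedDistance Ω d) (hΩ : IsOpen Ω)
    (hb : Bornology.IsBounded Ω) {δ : ℝ} (hδ : 0 < δ) : IsCompact {x : Ω | δ ≤ d x} := by
  rw [Subtype.isCompact_iff]
  have h1 : IsCompact (closure Ω ∩ d ⁻¹' Ici δ) :=
    hb.isCompact_closure.of_isClosed_subset
      (hd.contDiffOn.continuousOn.preimage_isClosed_of_isClosed isClosed_closure isClosed_Ici)
      inter_subset_left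
  convert! h1 using 1
  ext x
  constructor
  · rintro ⟨y, hy, rfl⟩
    exact ⟨subset_closure y.2, hy⟩
  · rintro ⟨hx, hxd⟩
    by_cases hxΩ : x ∈ Ω
    · exact ⟨⟨x, hxΩ⟩, hxd, rfl⟩
    · obtain ⟨ε, hε, h⟩ := hd.eq_dist
      have hfr : x ∈ frontier Ω := by
        rw [hΩ.frontier_eq]
        exact ⟨hx, hxΩ⟩
      have h0 : Metric.infDist x (frontier Ω) = 0 := Metric.infDist_zero_of_mem hfr
      have h2 := h x hx (h0.trans_le hε.le)
      rw [h0] at h2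
      exact absurd (mem_Ici.1 (mem_preimage.1 hxd)) (by rw [h2]; exact not_le.2 hδ)

/-- Near the boundary |p|^(q-1) ≤ (γ + 1) / d, and raising this to the power q / (q - 1) bounds
|p|^q by a multiple of the integrable weight; on the remaining compact set `p` is bounded. -/
theorem memLp_of_tendsto_boundary (hd : IsRegularizedDistance Ω d) (hΩ : IsOpen Ω)
    (hb : Bornology.IsBounded Ω) {q : ℝ} (hq : 1 < q) {p : Ω → Rn n} (hp : Continuous p)
    {γ : ℝ} (hγ : 0 < γ)
    (hlim : Tendsto (fun x : Ω => ‖p x‖ ^ (q - 1) * d x)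
      (comap (fun x : Ω => d x) (𝓝 0)) (𝓝 γ))
    {m : Measure Ω} [IsFiniteMeasure m]
    (hm : ∫⁻ x : Ω, ENNReal.ofReal (d x ^ (-(q / (q - 1)))) ∂m < ∞) :
    MemLp p (ENNReal.ofReal q) m := by
  have hq1 : 0 < q - 1 := by linarith
  rw [memLp_ofReal_iff_integrable_rpow (by linarith) hp.aestronglyMeasurable]
  have hdc : Continuous fun x : Ω => d x :=
    continuousOn_iff_continuous_domRestrict.1 (hd.contDiffOn.continuousOn.mono subset_closure)
  have hdpos : ∀ x : Ω, 0 < d x := fun x => hd.pos x x.2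
  have hint : Integrable (fun x : Ω => d x ^ (-(q / (q - 1)))) m :=
    ⟨(hdc.measurable.pow_const _).aestronglyMeasurable,
      (hasFiniteIntegral_iff_ofReal (Eventually.of_forall fun x => by
        have := hdpos x; positivity)).2 hm⟩
  obtain ⟨U, hU, hUlim⟩ := hlim.eventually (eventually_le_nhds (lt_add_one γ))
  obtain ⟨δ, hδ, hball⟩ := Metric.mem_nhds_iff.1 hU
  obtain ⟨M, hM⟩ := (hd.isCompact_le hΩ hb hδ).exists_bound_of_continuousOn hp.continuousOn
  refine ((hint.const_mul ((γ + 1) ^ (q / (q - 1)))).add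
    (integrable_const (|M| ^ q))).mono' ?_ (Eventually.of_forall fun x => ?_)
  · exact (hp.norm.measurable.pow_const _).aestronglyMeasurable
  have hx := hdpos x
  rw [Real.norm_of_nonneg (by positivity)]
  simp only [Pi.add_apply]
  rcases lt_or_ge (d x) δ with h | h
  · have h1 : ‖p x‖ ^ (q - 1) * d x ≤ γ + 1 := hUlim (hball (by
      rw [mem_ball_zero_iff, Real.norm_of_nonneg hx.le]; exact h))
    have h2 : ‖p x‖ ^ q ≤ (γ + 1) ^ (q / (q - 1)) * d x ^ (-(q / (q - 1))) := by
      calc ‖p x‖ ^ q = (‖p x‖ ^ (q - 1)) ^ (q / (q - 1)) := by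
            rw [← Real.rpow_mul (norm_nonneg _), mul_div_cancel₀ _ hq1.ne']
        _ ≤ ((γ + 1) / d x) ^ (q / (q - 1)) :=
            Real.rpow_le_rpow (by positivity) ((le_div_iff₀ hx).2 h1) (by positivity)
        _ = _ := by
            rw [Real.div_rpow (by positivity) hx.le, Real.rpow_neg hx.le, div_eq_mul_inv]
    have h3 : 0 ≤ |M| ^ q := by positivity
    linarith
  · have h1 : ‖p x‖ ^ q ≤ |M| ^ q :=
      Real.rpow_le_rpow (norm_nonneg _) ((hM x h).trans (le_abs_self _)) (by linarith)
    have h2 : 0 ≤ (γ + 1) ^ (q / (q - 1)) * d x ^ (-(q / (q - 1))) := by positivity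
    linarith

end Distance

/-! ### Monotonicity, a priori bounds and uniqueness. -/

/-- The standing assumptions on a Hamiltonian whose Lagrangian is monotone in the measure. -/
structure MonotoneHamiltonian {n : ℕ} {Ω : Set (Rn n)} {r : ℝ}
    (H : Rn n → MomentMeasure Ω r → ℝ) (C₀ : ℝ) : Prop where
  measurableSet : MeasurableSet Ω
  pos : 0 < C₀
  regular : HamiltonianRegular H
  bdd : LagrBdd H
  strictConvex : LagrangianStrictConvex H
  monotone : LagrangianMonotone H
  lower : LagrangianLowerBound H C₀
  bound : LagrangianBound H C₀

theorem integrable_inner_of_memLp {X E : Type*} [MeasurableSpace X] {m : Measure X}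
    [NormedAddCommGroup E] [InnerProductSpace ℝ E] {r q : ℝ} (h : r.HolderConjugate q)
    {a p : X → E} (ha : MemLp a (ENNReal.ofReal r) m) (hp : MemLp p (ENNReal.ofReal q) m) :
    Integrable (fun x => (inner ℝ (a x) (p x) : ℝ)) m := by
  refine (((ha.integrable_rpow h.pos).div_const r).add
    ((hp.integrable_rpow h.symm.pos).div_const q)).mono' (ha.1.inner hp.1)
    (Eventually.of_forall fun x => ?_)
  exact (abs_real_inner_le_norm _ _).trans
    (Real.young_inequality_of_nonneg (norm_nonneg _) (norm_nonneg _) h)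

theorem integrable_mul_norm_of_memLp {X E : Type*} [MeasurableSpace X] {m : Measure X}
    [NormedAddCommGroup E] {r q : ℝ} (h : r.HolderConjugate q)
    {k : X → ℝ} {p : X → E} (hk : MemLp k (ENNReal.ofReal r) m)
    (hp : MemLp p (ENNReal.ofReal q) m) : Integrable (fun x => k x * ‖p x‖) m := by
  simpa [mul_comm] using integrable_inner_of_memLp h hk hp.norm

namespace MonotoneHamiltonian

variable {n : ℕ} {Ω : Set (Rn n)} {r q C₀ : ℝ} {H : Rn n → MomentMeasure Ω r → ℝ}
  {m : ProbabilityMeasure Ω} {a b p : Ω → Rn n}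

theorem integrable_Lagr (hH : MonotoneHamiltonian H C₀) (hr : 0 < r)
    (ha : MemLp a (ENNReal.ofReal r) (m : Measure Ω)) (μ : MomentMeasure Ω r) :
    Integrable (fun x => Lagr H (a x) μ) (m : Measure Ω) := by
  refine ((((integrable_const (1 : ℝ)).add (ha.integrable_rpow hr)).add
    (integrable_const (Lam μ ^ r))).const_mul C₀).mono' ?_
    (Eventually.of_forall fun x => hH.bound _ _)
  exact ((hH.strictConvex.continuous μ).comp_aestronglyMeasurable ha.1)

/-- Monotonicity pulled back to controls; the only form in which it is used below. -/
theorem integral_Lagr_cross_le (hH : MonotoneHamiltonian H C₀) (hr : 0 < r)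
    (ha : MemLp a (ENNReal.ofReal r) (m : Measure Ω))
    (hb : MemLp b (ENNReal.ofReal r) (m : Measure Ω)) :
    ∫ x, Lagr H (a x) (controlLaw hr m b) ∂(m : Measure Ω) +
        ∫ x, Lagr H (b x) (controlLaw hr m a) ∂(m : Measure Ω) ≤
      ∫ x, Lagr H (a x) (controlLaw hr m a) ∂(m : Measure Ω) +
        ∫ x, Lagr H (b x) (controlLaw hr m b) ∂(m : Measure Ω) := by
  have h := hH.monotone (controlLaw hr m a) (controlLaw hr m b)
    (ae_mem_controlLaw hr hH.measurableSet ha) (ae_mem_controlLaw hr hH.measurableSet hb)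
  have hc : Continuous fun α => Lagr H α (controlLaw hr m a) - Lagr H α (controlLaw hr m b) :=
    (hH.strictConvex.continuous _).sub (hH.strictConvex.continuous _)
  rw [integral_controlLaw hr ha hc, integral_controlLaw hr hb hc,
    integral_sub (hH.integrable_Lagr hr ha _) (hH.integrable_Lagr hr ha _),
    integral_sub (hH.integrable_Lagr hr hb _) (hH.integrable_Lagr hr hb _)] at h
  linarith

/-- The a priori bound on the moment of a control that does better than the zero control against
the law of the zero control. -/
theorem Lam_rpow_le (hH : MonotoneHamiltonian H C₀) (h : r.HolderConjugate q)
    (ha : MemLp a (ENNReal.ofReal r) (m : Measure Ω))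
    (hp : MemLp p (ENNReal.ofReal q) (m : Measure Ω))
    (hle : ∫ x, Lagr H (a x) (controlLaw h.pos m 0) ∂(m : Measure Ω) +
        ∫ x, inner ℝ (a x) (p x) ∂(m : Measure Ω) ≤
      ∫ _, Lagr H 0 (controlLaw h.pos m 0) ∂(m : Measure Ω)) :
    Lam (controlLaw h.pos m a) ^ r ≤ 4 * C₀ ^ 2 + r ^ (q - 1) * (2 * C₀) ^ q / q *
      (eLpNorm p (ENNReal.ofReal q) (m : Measure Ω)).toReal ^ q := by
  have hC := hH.pos
  have hr1 : 1 ≤ r := h.lt.le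
  have h0 : Lam (controlLaw h.pos m 0) ^ r = 0 := by
    rw [Lam_controlLaw_rpow h.pos MemLp.zero]
    simp [Real.zero_rpow h.pos.ne']
  rw [Lam_controlLaw_rpow h.pos ha, hp.toReal_eLpNorm_rpow h.symm.pos]
  have hia := ha.integrable_rpow h.pos
  have hip := hp.integrable_rpow h.symm.pos
  have hinner := integrable_inner_of_memLp h ha hp
  set A := ∫ x, ‖a x‖ ^ r ∂(m : Measure Ω) with hA
  set B := ∫ x, ‖p x‖ ^ q ∂(m : Measure Ω) with hB
  set c := r ^ (q - 1) * (2 * C₀) ^ q / q with hc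
  have h1 : 1 / C₀ * A - C₀ ≤ ∫ x, Lagr H (a x) (controlLaw h.pos m 0) ∂(m : Measure Ω) := by
    calc 1 / C₀ * A - C₀ = ∫ x, (1 / C₀ * ‖a x‖ ^ r - C₀) ∂(m : Measure Ω) := by
          rw [integral_sub (hia.const_mul _) (integrable_const _), integral_const_mul]
          simp [hA]
      _ ≤ _ := integral_mono ((hia.const_mul _).sub (integrable_const _))
          (hH.integrable_Lagr h.pos ha _) fun x => by
            have := hH.lower (a x) (controlLaw h.pos m 0)
            rw [h0] at this
            simpa using this
  have h2 : ∫ _, Lagr H 0 (controlLaw h.pos m 0) ∂(m : Measure Ω) ≤ C₀ := by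
    have := (abs_le.1 (hH.bound 0 (controlLaw h.pos m 0))).2
    rw [h0, norm_zero, Real.zero_rpow h.pos.ne'] at this
    simpa using this
  -- Young's inequality for ‖a‖ and 2C₀‖p‖. The weight 2C₀ is chosen because doubling `h5` gives 2A
  -- on the left, so one `A` can be absorbed; the factor r^(q-1) ≥ 1 in `c` is slack.
  have h3 : -(∫ x, inner ℝ (a x) (p x) ∂(m : Measure Ω)) * (2 * C₀) ≤ A + c * B := by
    rw [← integral_neg, ← integral_mul_const, hA, hB, ← integral_const_mul,
      ← integral_add hia (hip.const_mul _)]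
    refine integral_mono (hinner.neg.mul_const _) (hia.add (hip.const_mul _)) fun x => ?_
    have e1 : -(inner ℝ (a x) (p x)) ≤ ‖a x‖ * ‖p x‖ :=
      (neg_le_abs _).trans (abs_real_inner_le_norm _ _)
    have e2 := Real.young_inequality_of_nonneg (norm_nonneg (a x))
      (by positivity : 0 ≤ 2 * C₀ * ‖p x‖) h
    have e3 : ‖a x‖ ^ r / r ≤ ‖a x‖ ^ r := div_le_self (by positivity) hr1
    have e4 : (2 * C₀ * ‖p x‖) ^ q / q ≤ c * ‖p x‖ ^ q := by
      have hq := h.symm.pos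
      rw [Real.mul_rpow (by positivity) (norm_nonneg _), hc, div_mul_eq_mul_div]
      have : 1 ≤ r ^ (q - 1) := Real.one_le_rpow hr1 h.symm.sub_one_pos.le
      gcongr
      exact le_mul_of_one_le_left (by positivity) this
    have e5 := mul_le_mul_of_nonneg_right e1 (by positivity : 0 ≤ 2 * C₀)
    dsimp only
    linarith
  have h4 : 1 / C₀ * A ≤ 2 * C₀ - ∫ x, inner ℝ (a x) (p x) ∂(m : Measure Ω) := by linarith
  have h5 : A ≤ (2 * C₀ - ∫ x, inner ℝ (a x) (p x) ∂(m : Measure Ω)) * C₀ := by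
    rwa [one_div, ← div_eq_inv_mul, div_le_iff₀ hC] at h4
  linarith

theorem Lagr_feedback (hH : MonotoneHamiltonian H C₀) (p : Rn n) (μ : MomentMeasure Ω r) :
    Lagr H (-DpH H p μ) μ + inner ℝ (-DpH H p μ) p = -H p μ := by
  rw [Lagr_neg_DpH (fun μ => (hH.regular.strictConvex μ).convexOn) hH.regular.differentiable
    hH.bdd]
  ring

theorem neg_le_Lagr_add (hH : MonotoneHamiltonian H C₀) (α p : Rn n) (μ : MomentMeasure Ω r) :
    -H p μ ≤ Lagr H α μ + inner ℝ α p := by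
  have := hH.bdd.fenchel α p μ
  linarith

theorem eq_feedback (hH : MonotoneHamiltonian H C₀) {α p : Rn n} {μ : MomentMeasure Ω r}
    (h : Lagr H α μ + inner ℝ α p ≤ -H p μ) : α = -DpH H p μ :=
  eq_neg_DpH_of_Lagr_le hH.regular.differentiable hH.bdd (by linarith)

theorem continuous_feedback (hH : MonotoneHamiltonian H C₀) (hp : Continuous p)
    (μ : MomentMeasure Ω r) : Continuous fun x => -DpH H (p x) μ :=
  (hH.regular.continuous_DpH.comp (hp.prodMk continuous_const)).neg

/-- The feedback does at least as well as the control 0, so coercivity gives β^r ≤ C₀β‖p‖ + 2C₀²(1 +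
M) for its norm β. For β ≥ 1 divide by β and use (r - 1)(q - 1) = 1. -/
theorem norm_DpH_le (hH : MonotoneHamiltonian H C₀) (h : r.HolderConjugate q) (p : Rn n)
    (μ : MomentMeasure Ω r) {M : ℝ} (hM : Lam μ ^ r ≤ M) :
    ‖DpH H p μ‖ ≤ (1 + 2 * C₀ ^ 2 * (1 + M) + C₀ * ‖p‖) ^ (q - 1) := by
  have hC := hH.pos
  have hq1 := h.symm.sub_one_pos
  have hL : 0 ≤ Lam μ ^ r := Real.rpow_nonneg (Lam_nonneg μ) _
  have hM0 : 0 ≤ M := hL.trans hM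
  set β := ‖DpH H p μ‖ with hβ
  have hβ0 : 0 ≤ β := norm_nonneg _
  have hbase : 1 ≤ 1 + 2 * C₀ ^ 2 * (1 + M) + C₀ * ‖p‖ := by
    have : 0 ≤ 2 * C₀ ^ 2 * (1 + M) + C₀ * ‖p‖ := by positivity
    linarith
  rcases le_total β 1 with h1 | h1
  · exact h1.trans (Real.one_le_rpow hbase hq1.le)
  have e1 := hH.Lagr_feedback p μ
  have e2 := hH.neg_le_Lagr_add 0 p μ
  have e3 := (abs_le.1 (hH.bound 0 μ)).2
  have e4 := hH.lower (-DpH H p μ) μ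
  have e5 : inner ℝ (DpH H p μ) p ≤ β * ‖p‖ := real_inner_le_norm _ _
  rw [norm_zero, Real.zero_rpow h.pos.ne', add_zero] at e3
  rw [inner_zero_left] at e2
  rw [inner_neg_left] at e1
  rw [norm_neg, ← hβ] at e4
  have e6 : 1 / C₀ * β ^ r ≤ β * ‖p‖ + 2 * C₀ * (1 + M) := by
    have : C₀ * (1 + Lam μ ^ r) ≤ C₀ * (1 + M) := by gcongr
    linarith
  have e7 : β ^ r ≤ (β * ‖p‖ + 2 * C₀ * (1 + M)) * C₀ := by
    rwa [one_div, ← div_eq_inv_mul, div_le_iff₀ hC] at e6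
  have e8 : β ^ r = β ^ (r - 1) * β := by
    rw [← Real.rpow_add_one' hβ0 (by linarith [h.pos])]; ring_nf
  have e9 : β ^ (r - 1) ≤ 1 + 2 * C₀ ^ 2 * (1 + M) + C₀ * ‖p‖ := by
    have hpos : 0 < β := by linarith
    refine le_of_mul_le_mul_right ?_ hpos
    rw [← e8]
    have : 0 ≤ (2 * C₀ ^ 2 * (1 + M)) * (β - 1) :=
      mul_nonneg (by positivity) (by linarith)
    nlinarith
  calc β = (β ^ (r - 1)) ^ (q - 1) := by
        rw [← Real.rpow_mul hβ0]
        have : (r - 1) * (q - 1) = 1 := by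
          have := h.mul_eq_add
          linarith
        rw [this, Real.rpow_one]
    _ ≤ _ := Real.rpow_le_rpow (by positivity) e9 hq1.le

theorem fixedPoint_eq_controlLaw (hH : MonotoneHamiltonian H C₀) (hr : 0 < r)
    (hp : Continuous p) {μ : MomentMeasure Ω r} (hμ : IsFixedPointLaw H p (m : Measure Ω) μ) :
    MemLp (fun x => -DpH H (p x) μ) (ENNReal.ofReal r) (m : Measure Ω) ∧
      μ = controlLaw hr m (fun x => -DpH H (p x) μ) := by
  have hmeas := (hH.continuous_feedback hp μ).aestronglyMeasurable (μ := (m : Measure Ω))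
  have ha : MemLp (fun x => -DpH H (p x) μ) (ENNReal.ofReal r) (m : Measure Ω) := by
    refine ⟨hmeas, ?_⟩
    rw [← controlMoment_graphLaw hr hmeas.aemeasurable]
    exact (congrArg (controlMoment r) hμ).symm.trans_lt μ.2
  exact ⟨ha, Subtype.ext (Subtype.ext (hμ.trans (coe_controlLaw hr ha).symm))⟩

theorem fixedPoint_unique (hH : MonotoneHamiltonian H C₀) (hr : 0 < r) (hp : Continuous p)
    {μ₁ μ₂ : MomentMeasure Ω r} (h₁ : IsFixedPointLaw H p (m : Measure Ω) μ₁)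
    (h₂ : IsFixedPointLaw H p (m : Measure Ω) μ₂) : μ₁ = μ₂ := by
  obtain ⟨ha, ea⟩ := hH.fixedPoint_eq_controlLaw hr hp h₁
  obtain ⟨hb, eb⟩ := hH.fixedPoint_eq_controlLaw hr hp h₂
  have hmono := hH.integral_Lagr_cross_le hr ha hb
  rw [← ea, ← eb] at hmono
  set a := fun x => -DpH H (p x) μ₁ with ha_def
  set b := fun x => -DpH H (p x) μ₂ with hb_def
  have i1 := hH.integrable_Lagr hr ha μ₁
  have i2 := hH.integrable_Lagr hr ha μ₂
  have i3 := hH.integrable_Lagr hr hb μ₁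
  have i4 := hH.integrable_Lagr hr hb μ₂
  -- This is the sum of the Fenchel defects of `a x` against `μ₂` and of `b x` against `μ₁`.
  -- Monotonicity makes its integral nonpositive, so both defects vanish almost everywhere.
  have hnn : ∀ x, 0 ≤ (Lagr H (a x) μ₂ + Lagr H (b x) μ₁)
      - (Lagr H (a x) μ₁ + Lagr H (b x) μ₂) := fun x => by
    have e1 := hH.Lagr_feedback (p x) μ₁
    have e2 := hH.Lagr_feedback (p x) μ₂
    have e3 := hH.neg_le_Lagr_add (a x) (p x) μ₂
    have e4 := hH.neg_le_Lagr_add (b x) (p x) μ₁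
    simp only [ha_def, hb_def] at *
    linarith
  have i23 : Integrable (fun x => Lagr H (a x) μ₂ + Lagr H (b x) μ₁) (m : Measure Ω) := i2.add i3
  have i14 : Integrable (fun x => Lagr H (a x) μ₁ + Lagr H (b x) μ₂) (m : Measure Ω) := i1.add i4
  have hzero : ∫ x, ((Lagr H (a x) μ₂ + Lagr H (b x) μ₁)
      - (Lagr H (a x) μ₁ + Lagr H (b x) μ₂)) ∂(m : Measure Ω) = 0 := by
    refine le_antisymm ?_ (integral_nonneg hnn)
    rw [integral_sub i23 i14, integral_add i2 i3, integral_add i1 i4]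
    linarith
  rw [integral_eq_zero_iff_of_nonneg hnn (i23.sub i14)] at hzero
  rw [ea, eb]
  refine controlLaw_congr hr ?_
  filter_upwards [hzero] with x hx
  refine hH.eq_feedback ?_
  have e1 := hH.Lagr_feedback (p x) μ₁
  have e2 := hH.Lagr_feedback (p x) μ₂
  have e4 := hH.neg_le_Lagr_add (b x) (p x) μ₁
  simp only [ha_def, hb_def, Pi.zero_apply] at *
  linarith

/-- The feedback beats the zero control against `μ`; the crossed inequality transfers this to the
law of the zero control, whose moment is 0. -/
theorem fixedPoint_Lam_rpow_le (hH : MonotoneHamiltonian H C₀) (h : r.HolderConjugate q)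
    (hp : Continuous p) (hpq : MemLp p (ENNReal.ofReal q) (m : Measure Ω))
    {μ : MomentMeasure Ω r} (hμ : IsFixedPointLaw H p (m : Measure Ω) μ) :
    Lam μ ^ r ≤ 4 * C₀ ^ 2 + r ^ (q - 1) * (2 * C₀) ^ q / q *
      (eLpNorm p (ENNReal.ofReal q) (m : Measure Ω)).toReal ^ q := by
  obtain ⟨ha, ea⟩ := hH.fixedPoint_eq_controlLaw h.pos hp hμ
  have hmono := hH.integral_Lagr_cross_le h.pos ha MemLp.zero
  rw [← ea] at hmono
  rw [ea]
  refine hH.Lam_rpow_le h ha hpq ?_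
  have i0 := hH.integrable_Lagr h.pos ha μ
  have hin := integrable_inner_of_memLp h ha hpq
  have h1 : ∫ x, Lagr H (-DpH H (p x) μ) μ ∂(m : Measure Ω)
      + ∫ x, inner ℝ (-DpH H (p x) μ) (p x) ∂(m : Measure Ω)
      ≤ ∫ x, Lagr H ((0 : Ω → Rn n) x) μ ∂(m : Measure Ω) := by
    rw [← integral_add i0 hin]
    refine integral_mono (i0.add hin) (hH.integrable_Lagr h.pos MemLp.zero μ) fun x => ?_
    have e1 := hH.Lagr_feedback (p x) μ
    have e2 := hH.neg_le_Lagr_add 0 (p x) μ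
    rw [inner_zero_left] at e2
    simp only [Pi.zero_apply]
    linarith
  simp only [Pi.zero_apply] at *
  linarith

end MonotoneHamiltonian

/-! ### Pointwise dominated controls in L². -/

section Dominated

variable {X E : Type*} [MeasurableSpace X] {m : Measure X} [NormedAddCommGroup E]

/-- The elements of `L²` whose norm is almost everywhere at most `k`. -/
def dominatedSet (m : Measure X) (E : Type*) [NormedAddCommGroup E] (k : X → ℝ) :
    Set (Lp E 2 m) :=
  {a | ∀ᵐ x ∂m, ‖a x‖ ≤ k x}

variable {k : X → ℝ}

theorem isClosed_dominatedSet : IsClosed (dominatedSet m E k) := by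
  refine IsSeqClosed.isClosed fun u a hu ha => ?_
  obtain ⟨φ, -, hφ⟩ := (tendstoInMeasure_of_tendsto_Lp ha).exists_seq_tendsto_ae
  have hall : ∀ᵐ x ∂m, ∀ j, ‖u j x‖ ≤ k x := ae_all_iff.2 hu
  filter_upwards [hφ, hall] with x hx hb
  exact le_of_tendsto hx.norm (Eventually.of_forall fun j => hb _)

theorem convex_dominatedSet [NormedSpace ℝ E] : Convex ℝ (dominatedSet m E k) := by
  intro a ha b hb s t hs ht hst
  filter_upwards [ha, hb, Lp.coeFn_add (s • a) (t • b), Lp.coeFn_smul s a, Lp.coeFn_smul t b]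
    with x h1 h2 h3 h4 h5
  rw [h3, Pi.add_apply, h4, h5, Pi.smul_apply, Pi.smul_apply]
  calc ‖s • a x + t • b x‖ ≤ s * ‖a x‖ + t * ‖b x‖ := by
        refine (norm_add_le _ _).trans_eq ?_
        rw [norm_smul, norm_smul, Real.norm_of_nonneg hs, Real.norm_of_nonneg ht]
    _ ≤ s * k x + t * k x := by gcongr
    _ = k x := by rw [← add_mul, hst, one_mul]

theorem isBounded_dominatedSet (hk : MemLp k 2 m) :
    Bornology.IsBounded (dominatedSet m E k) := by
  refine (Metric.isBounded_closedBall (x := (0 : Lp E 2 m)) (r := ‖hk.toLp k‖)).subset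
    fun a ha => ?_
  rw [mem_closedBall_zero_iff]
  refine Lp.norm_le_norm_of_ae_le ?_
  filter_upwards [ha, hk.coeFn_toLp] with x h1 h2
  rw [h2]
  exact h1.trans (le_abs_self _)

theorem zero_mem_dominatedSet (hk : ∀ x, 0 ≤ k x) : (0 : Lp E 2 m) ∈ dominatedSet m E k := by
  filter_upwards [Lp.coeFn_zero E 2 m] with x hx
  rw [hx]
  simpa using hk x

/-- Integral functionals with a continuous integrand, dominated on `dominatedSet m E k`, are
continuous there. -/
theorem continuousOn_integral_dominatedSet {φ : X → E → ℝ} (hφ : ∀ x, Continuous (φ x))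
    (hmeas : ∀ a ∈ dominatedSet m E k, AEStronglyMeasurable (fun x => φ x (a x)) m)
    {g : X → ℝ} (hg : Integrable g m)
    (hbound : ∀ x, ∀ α, ‖α‖ ≤ k x → |φ x α| ≤ g x) :
    ContinuousOn (fun a : Lp E 2 m => ∫ x, φ x (a x) ∂m) (dominatedSet m E k) := by
  intro a ha
  -- Convergence in L² gives almost everywhere convergence only along a subsequence, which is enough
  -- for continuity.
  refine tendsto_of_subseq_tendsto fun u hu => ?_
  obtain ⟨hua, huK⟩ := tendsto_nhdsWithin_iff.1 hu
  obtain ⟨ψ, hψ, hlim⟩ := (tendstoInMeasure_of_tendsto_Lp hua).exists_seq_tendsto_ae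
  have hK := hψ.tendsto_atTop.eventually huK
  refine ⟨ψ, tendsto_integral_filter_of_dominated_convergence g ?_ ?_ hg ?_⟩
  · filter_upwards [hK] with j hj using hmeas _ hj
  · filter_upwards [hK] with j hj
    filter_upwards [hj] with x hx using hbound x _ hx
  · filter_upwards [hlim] with x hx
    exact ((hφ x).tendsto _).comp hx

end Dominated

/-! ### Existence by Minty's method. -/

namespace MonotoneHamiltonian

variable {n : ℕ} {Ω : Set (Rn n)} {r q C₀ : ℝ} {H : Rn n → MomentMeasure Ω r → ℝ}
  {m : ProbabilityMeasure Ω} {p : Ω → Rn n} {k : Ω → ℝ}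

theorem memLp_of_mem_dominatedSet (hk : MemLp k (ENNReal.ofReal r) (m : Measure Ω))
    {a : Lp (Rn n) 2 (m : Measure Ω)} (ha : a ∈ dominatedSet (m : Measure Ω) (Rn n) k) :
    MemLp a (ENNReal.ofReal r) (m : Measure Ω) :=
  hk.mono' (Lp.aestronglyMeasurable a) ha

/-- The gain of the control `b` over the control `a` against the law of `b`. -/
noncomputable def gap (H : Rn n → MomentMeasure Ω r → ℝ) (hr : 0 < r) (m : ProbabilityMeasure Ω)
    (p : Ω → Rn n) (b a : Lp (Rn n) 2 (m : Measure Ω)) : ℝ :=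
  ∫ x, (Lagr H (a x) (controlLaw hr m b) - Lagr H (b x) (controlLaw hr m b)
    + inner ℝ (a x - b x) (p x)) ∂(m : Measure Ω)

theorem integrable_gap (hH : MonotoneHamiltonian H C₀) (h : r.HolderConjugate q)
    (hp : MemLp p (ENNReal.ofReal q) (m : Measure Ω)) {a b : Ω → Rn n}
    (ha : MemLp a (ENNReal.ofReal r) (m : Measure Ω))
    (hb : MemLp b (ENNReal.ofReal r) (m : Measure Ω)) (μ : MomentMeasure Ω r) :
    Integrable (fun x => Lagr H (a x) μ - Lagr H (b x) μ + inner ℝ (a x - b x) (p x))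
      (m : Measure Ω) :=
  ((hH.integrable_Lagr h.pos ha μ).sub (hH.integrable_Lagr h.pos hb μ)).add
    (integrable_inner_of_memLp h (ha.sub hb) hp)

theorem integral_gap (hH : MonotoneHamiltonian H C₀) (h : r.HolderConjugate q)
    (hp : MemLp p (ENNReal.ofReal q) (m : Measure Ω)) {a b : Ω → Rn n}
    (ha : MemLp a (ENNReal.ofReal r) (m : Measure Ω))
    (hb : MemLp b (ENNReal.ofReal r) (m : Measure Ω)) (μ : MomentMeasure Ω r) :
    ∫ x, (Lagr H (a x) μ - Lagr H (b x) μ + inner ℝ (a x - b x) (p x)) ∂(m : Measure Ω) =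
      ∫ x, Lagr H (a x) μ ∂(m : Measure Ω) - ∫ x, Lagr H (b x) μ ∂(m : Measure Ω)
        + (∫ x, inner ℝ (a x) (p x) ∂(m : Measure Ω)
          - ∫ x, inner ℝ (b x) (p x) ∂(m : Measure Ω)) := by
  have ia := hH.integrable_Lagr h.pos ha μ
  have ib := hH.integrable_Lagr h.pos hb μ
  have iab : Integrable (fun x => Lagr H (a x) μ - Lagr H (b x) μ) (m : Measure Ω) := ia.sub ib
  have ja := integrable_inner_of_memLp h ha hp
  have jb := integrable_inner_of_memLp h hb hp
  have jab : Integrable (fun x => (inner ℝ (a x) (p x) : ℝ) - inner ℝ (b x) (p x))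
      (m : Measure Ω) := ja.sub jb
  simp_rw [inner_sub_left]
  rw [integral_add iab jab, integral_sub ia ib, integral_sub ja jb]

theorem convexOn_gap (hH : MonotoneHamiltonian H C₀) (h : r.HolderConjugate q)
    (hp : MemLp p (ENNReal.ofReal q) (m : Measure Ω))
    (hk : MemLp k (ENNReal.ofReal r) (m : Measure Ω)) {b : Lp (Rn n) 2 (m : Measure Ω)}
    (hb : b ∈ dominatedSet (m : Measure Ω) (Rn n) k) :
    ConvexOn ℝ (dominatedSet (m : Measure Ω) (Rn n) k) (gap H h.pos m p b) := by
  refine ⟨convex_dominatedSet, fun u hu v hv s t hs ht hst => ?_⟩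
  have hint := fun a (ha : a ∈ dominatedSet (m : Measure Ω) (Rn n) k) =>
    hH.integrable_gap h hp (memLp_of_mem_dominatedSet hk ha) (memLp_of_mem_dominatedSet hk hb)
      (controlLaw h.pos m b)
  simp only [gap, smul_eq_mul]
  rw [← integral_const_mul, ← integral_const_mul,
    ← integral_add ((hint u hu).const_mul s) ((hint v hv).const_mul t)]
  refine integral_mono_ae (hint _ (convex_dominatedSet hu hv hs ht hst))
    (((hint u hu).const_mul s).add ((hint v hv).const_mul t)) ?_
  filter_upwards [Lp.coeFn_add (s • u) (t • v), Lp.coeFn_smul s u, Lp.coeFn_smul t v]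
    with x h3 h4 h5
  rw [h3, Pi.add_apply, h4, h5, Pi.smul_apply, Pi.smul_apply]
  have e1 := (hH.strictConvex (controlLaw h.pos m b)).convexOn.2 (mem_univ (u x)) (mem_univ (v x))
    hs ht hst
  simp only [smul_eq_mul] at e1
  simp only [inner_sub_left, inner_add_left, real_inner_smul_left]
  obtain rfl : t = 1 - s := by linarith
  linarith

theorem continuousOn_gap (hH : MonotoneHamiltonian H C₀) (h : r.HolderConjugate q)
    (hp : MemLp p (ENNReal.ofReal q) (m : Measure Ω))
    (hk : MemLp k (ENNReal.ofReal r) (m : Measure Ω)) {b : Lp (Rn n) 2 (m : Measure Ω)}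
    (hb : b ∈ dominatedSet (m : Measure Ω) (Rn n) k) :
    ContinuousOn (gap H h.pos m p b) (dominatedSet (m : Measure Ω) (Rn n) k) := by
  have hC := hH.pos
  have hbr := memLp_of_mem_dominatedSet hk hb
  set μ := controlLaw h.pos m b with hμ
  have hkr := hk.integrable_rpow h.pos
  have hkp := integrable_mul_norm_of_memLp h hk hp
  have hbp := integrable_mul_norm_of_memLp h hbr.norm hp
  refine continuousOn_integral_dominatedSet
    (φ := fun x α => Lagr H α μ - Lagr H (b x) μ + inner ℝ (α - b x) (p x))
    (g := fun x => C₀ * (1 + ‖k x‖ ^ r + Lam μ ^ r) + |Lagr H (b x) μ|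
      + (k x * ‖p x‖ + ‖b x‖ * ‖p x‖)) (fun x => ?_) (fun a ha => ?_) ?_
    (fun x α hα => ?_)
  · have := hH.strictConvex.continuous μ
    fun_prop
  · exact (hH.integrable_gap h hp (memLp_of_mem_dominatedSet hk ha) hbr μ).aestronglyMeasurable
  · exact ((((((integrable_const 1).add hkr).add (integrable_const _)).const_mul C₀).add
      (hH.integrable_Lagr h.pos hbr μ).abs).add (hkp.add hbp))
  · have e1 := hH.bound α μ
    have e2 : ‖α‖ ^ r ≤ ‖k x‖ ^ r :=
      Real.rpow_le_rpow (norm_nonneg _) (hα.trans (le_abs_self _)) h.pos.le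
    have e3 : C₀ * (1 + ‖α‖ ^ r + Lam μ ^ r) ≤ C₀ * (1 + ‖k x‖ ^ r + Lam μ ^ r) := by gcongr
    have e4 : |inner ℝ (α - b x) (p x)| ≤ k x * ‖p x‖ + ‖b x‖ * ‖p x‖ := by
      rw [← add_mul]
      exact (abs_real_inner_le_norm _ _).trans (mul_le_mul_of_nonneg_right
        ((norm_sub_le _ _).trans (by gcongr)) (norm_nonneg _))
    have e5 : |Lagr H α μ - Lagr H (b x) μ| ≤ |Lagr H α μ| + |Lagr H (b x) μ| := abs_sub _ _
    have e6 := abs_add_le (Lagr H α μ - Lagr H (b x) μ) (inner ℝ (α - b x) (p x))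
    linarith

/-- The terms in `p` cancel, leaving the crossed inequality. -/
theorem gap_add_gap_nonpos (hH : MonotoneHamiltonian H C₀) (h : r.HolderConjugate q)
    (hp : MemLp p (ENNReal.ofReal q) (m : Measure Ω)) {a b : Lp (Rn n) 2 (m : Measure Ω)}
    (ha : MemLp a (ENNReal.ofReal r) (m : Measure Ω))
    (hb : MemLp b (ENNReal.ofReal r) (m : Measure Ω)) :
    gap H h.pos m p a b + gap H h.pos m p b a ≤ 0 := by
  have := hH.integral_Lagr_cross_le h.pos ha hb
  rw [gap, gap, hH.integral_gap h hp hb ha, hH.integral_gap h hp ha hb]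
  linarith

/-- Along the segment from `a` to `b` the gap is upper semicontinuous at `a`: Minty's argument. -/
theorem gap_nonneg_of_minty (hH : MonotoneHamiltonian H C₀) (h : r.HolderConjugate q)
    (hp : MemLp p (ENNReal.ofReal q) (m : Measure Ω))
    (hk : MemLp k (ENNReal.ofReal r) (m : Measure Ω)) {a b : Lp (Rn n) 2 (m : Measure Ω)}
    (ha : a ∈ dominatedSet (m : Measure Ω) (Rn n) k)
    (hb : b ∈ dominatedSet (m : Measure Ω) (Rn n) k)
    (hminty : ∀ c ∈ dominatedSet (m : Measure Ω) (Rn n) k, gap H h.pos m p c a ≤ 0) :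
    0 ≤ gap H h.pos m p a b := by
  have hC := hH.pos
  set t : ℕ → ℝ := fun j => 1 / ((j : ℝ) + 1) with ht
  have ht0 : ∀ j, 0 < t j := fun j => by positivity
  have ht1 : ∀ j, t j ≤ 1 := fun j => by
    rw [ht, div_le_one (by positivity)]
    linarith [(Nat.cast_nonneg j : (0 : ℝ) ≤ j)]
  have htlim : Tendsto t atTop (𝓝 0) := tendsto_one_div_add_atTop_nhds_zero_nat
  set c : ℕ → Lp (Rn n) 2 (m : Measure Ω) := fun j => (1 - t j) • a + t j • b with hc
  have hcK : ∀ j, c j ∈ dominatedSet (m : Measure Ω) (Rn n) k := fun j =>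
    convex_dominatedSet ha hb (by linarith [ht1 j]) (ht0 j).le (by ring)
  have hcr := fun j => memLp_of_mem_dominatedSet hk (hcK j)
  have har := memLp_of_mem_dominatedSet hk ha
  have hbr := memLp_of_mem_dominatedSet hk hb
  -- Convexity gives 0 = gap(c, c) ≤ (1 - t) gap(c, a) + t gap(c, b), where the Minty inequality
  -- makes the first term nonpositive.
  have hnonneg : ∀ j, 0 ≤ gap H h.pos m p (c j) b := fun j => by
    have e1 := (hH.convexOn_gap h hp hk (hcK j)).2 ha hb (by linarith [ht1 j] : 0 ≤ 1 - t j)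
      (ht0 j).le (by ring)
    have e2 : gap H h.pos m p (c j) (c j) = 0 := by simp [gap]
    have e3 := mul_nonpos_of_nonneg_of_nonpos (by linarith [ht1 j] : 0 ≤ 1 - t j)
      (hminty _ (hcK j))
    simp only [smul_eq_mul] at e1
    change gap H h.pos m p (c j) (c j) ≤ _ at e1
    exact nonneg_of_mul_nonneg_right (by linarith : 0 ≤ t j * gap H h.pos m p (c j) b) (ht0 j)
  have hclim : ∀ᵐ x ∂(m : Measure Ω), Tendsto (fun j => c j x) atTop (𝓝 (a x)) := by
    have hall : ∀ᵐ x ∂(m : Measure Ω), ∀ j, c j x = (1 - t j) • a x + t j • b x :=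
      ae_all_iff.2 fun j => by
        filter_upwards [Lp.coeFn_add ((1 - t j) • a) (t j • b), Lp.coeFn_smul (1 - t j) a,
          Lp.coeFn_smul (t j) b] with x h3 h4 h5
        rw [hc, h3, Pi.add_apply, h4, h5, Pi.smul_apply, Pi.smul_apply]
    filter_upwards [hall] with x hx
    simp_rw [hx]
    have := (((tendsto_const_nhds (x := (1 : ℝ))).sub htlim).smul_const (a x)).add
      (htlim.smul_const (b x))
    simpa using this
  have hμlim := tendsto_controlLaw h.pos hcr har hclim
  set B := ∫ x, ‖k x‖ ^ r ∂(m : Measure Ω) with hB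
  have hkr := hk.integrable_rpow h.pos
  have hLam : ∀ j, Lam (controlLaw h.pos m (c j)) ^ r ≤ B := fun j => by
    rw [Lam_controlLaw_rpow h.pos (hcr j)]
    refine integral_mono_ae ((hcr j).integrable_rpow h.pos) hkr ?_
    filter_upwards [hcK j] with x hx
    exact Real.rpow_le_rpow (norm_nonneg _) (hx.trans (le_abs_self _)) h.pos.le
  have hLam' : ∀ j, Lam (controlLaw h.pos m (c j)) ≤ B ^ r⁻¹ := fun j => by
    have := Real.rpow_le_rpow (Real.rpow_nonneg (Lam_nonneg _) _) (hLam j)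
      (inv_nonneg.2 h.pos.le)
    rwa [Real.rpow_rpow_inv (Lam_nonneg _) h.pos.ne'] at this
  have hkp := integrable_mul_norm_of_memLp h hk hp
  have hbound : ∀ (j : ℕ) (x : Ω) (α : Rn n), ‖α‖ ≤ k x →
      |Lagr H α (controlLaw h.pos m (c j))| ≤ C₀ * (1 + ‖k x‖ ^ r + B) := fun j x α hα => by
    refine (hH.bound _ _).trans ?_
    have e2 : ‖α‖ ^ r ≤ ‖k x‖ ^ r :=
      Real.rpow_le_rpow (norm_nonneg _) (hα.trans (le_abs_self _)) h.pos.le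
    have e3 := hLam j
    gcongr
  have hlim : Tendsto (fun j => gap H h.pos m p (c j) b) atTop (𝓝 (gap H h.pos m p a b)) := by
    refine tendsto_integral_of_dominated_convergence
      (fun x => C₀ * (1 + ‖k x‖ ^ r + B) + C₀ * (1 + ‖k x‖ ^ r + B)
        + (k x * ‖p x‖ + k x * ‖p x‖))
      (fun j => (hH.integrable_gap h hp hbr (hcr j) _).aestronglyMeasurable) ?_ ?_ ?_
    · have i1 := (((integrable_const (1 : ℝ)).add hkr).add (integrable_const B)).const_mul C₀
      exact (i1.add i1).add (hkp.add hkp)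
    · intro j
      filter_upwards [hb, hcK j] with x h1 h2
      have e1 := hbound j x _ h1
      have e2 := hbound j x _ h2
      have e4 : |inner ℝ (b x - c j x) (p x)| ≤ k x * ‖p x‖ + k x * ‖p x‖ := by
        rw [← add_mul]
        exact (abs_real_inner_le_norm _ _).trans (mul_le_mul_of_nonneg_right
          ((norm_sub_le _ _).trans (add_le_add h1 h2)) (norm_nonneg _))
      have e5 := abs_sub (Lagr H (b x) (controlLaw h.pos m (c j)))
        (Lagr H (c j x) (controlLaw h.pos m (c j)))
      refine (abs_add_le _ _).trans ?_
      linarith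
    · filter_upwards [hclim] with x hx
      refine ((tendsto_Lagr hC h.pos.le hH.bound hH.bdd hH.regular.continuous_H
        tendsto_const_nhds hμlim hLam').sub (tendsto_Lagr hC h.pos.le hH.bound hH.bdd
        hH.regular.continuous_H hx hμlim hLam')).add ?_
      exact (tendsto_const_nhds.sub hx).inner tendsto_const_nhds
  exact ge_of_tendsto' hlim hnonneg

/-- Existence of a fixed point, given an a priori bound `k` on the feedback controls. -/
theorem exists_fixedPoint_of_feedback_le (hH : MonotoneHamiltonian H C₀) (h : r.HolderConjugate q)
    (hr2 : 2 ≤ r) (hp : Continuous p)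
    (hpq : MemLp p (ENNReal.ofReal q) (m : Measure Ω)) (hk0 : ∀ x, 0 ≤ k x)
    (hk : MemLp k (ENNReal.ofReal r) (m : Measure Ω))
    (hpk : ∀ x, ∀ μ : MomentMeasure Ω r, Lam μ ^ r ≤ 4 * C₀ ^ 2 +
      r ^ (q - 1) * (2 * C₀) ^ q / q *
        (eLpNorm p (ENNReal.ofReal q) (m : Measure Ω)).toReal ^ q → ‖DpH H (p x) μ‖ ≤ k x) :
    ∃ μ : MomentMeasure Ω r, IsFixedPointLaw H p (m : Measure Ω) μ := by
  -- Since r ≥ 2 and `m` is finite, L^r embeds in L², so Hilbert space weak compactness applies.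
  have h2r : (2 : ℝ≥0∞) ≤ ENNReal.ofReal r := by
    rw [← ENNReal.ofReal_ofNat]
    exact ENNReal.ofReal_le_ofReal hr2
  have hzero : (0 : Lp (Rn n) 2 (m : Measure Ω)) ∈ dominatedSet (m : Measure Ω) (Rn n) k :=
    zero_mem_dominatedSet hk0
  obtain ⟨a, haK, ha⟩ := exists_minty_equilibrium ⟨_, hzero⟩ convex_dominatedSet
    isClosed_dominatedSet (isBounded_dominatedSet (hk.mono_exponent h2r)) (gap H h.pos m p)
    (fun b hb => hH.convexOn_gap h hpq hk hb) (fun b hb => hH.continuousOn_gap h hpq hk hb)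
    (fun a ha b hb => hH.gap_add_gap_nonpos h hpq (memLp_of_mem_dominatedSet hk ha)
      (memLp_of_mem_dominatedSet hk hb))
  have har := memLp_of_mem_dominatedSet hk haK
  set μ := controlLaw h.pos m a with hμ
  -- The Minty inequality tested at 0 is exactly what the a priori bound needs. That bound does not
  -- involve `k`, which avoids circularity.
  have hLam := hH.Lam_rpow_le h har hpq (by
    have e1 := ha 0 hzero
    rw [gap, hH.integral_gap h hpq har (memLp_of_mem_dominatedSet hk hzero),
      controlLaw_congr h.pos (Lp.coeFn_zero _ _ _)] at e1
    have e2 : ∫ x, Lagr H ((0 : Lp (Rn n) 2 (m : Measure Ω)) x) (controlLaw h.pos m 0)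
        ∂(m : Measure Ω) = ∫ _, Lagr H 0 (controlLaw h.pos m 0) ∂(m : Measure Ω) := by
      refine integral_congr_ae ?_
      filter_upwards [Lp.coeFn_zero (Rn n) 2 (m : Measure Ω)] with x hx
      rw [hx, Pi.zero_apply]
    have e3 : ∫ x, inner ℝ ((0 : Lp (Rn n) 2 (m : Measure Ω)) x) (p x) ∂(m : Measure Ω) = 0 := by
      refine integral_eq_zero_of_ae ?_
      filter_upwards [Lp.coeFn_zero (Rn n) 2 (m : Measure Ω)] with x hx
      rw [hx, Pi.zero_apply, inner_zero_left, Pi.zero_apply]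
    linarith)
  have hfc := hH.continuous_feedback hp μ
  have hfk : ∀ x, ‖-DpH H (p x) μ‖ ≤ k x := fun x => by
    rw [norm_neg]
    exact hpk x μ hLam
  have hfr : MemLp (fun x => -DpH H (p x) μ) (ENNReal.ofReal r) (m : Measure Ω) :=
    hk.mono' hfc.aestronglyMeasurable (Eventually.of_forall hfk)
  have hf2 := hfr.mono_exponent h2r
  have hfcoe := hf2.coeFn_toLp
  have hfK : hf2.toLp _ ∈ dominatedSet (m : Measure Ω) (Rn n) k := by
    filter_upwards [hfcoe] with x hx
    rw [hx]
    exact hfk x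
  have hgap := hH.gap_nonneg_of_minty h hpq hk haK hfK ha
  -- Against the feedback, the gap is minus the integrated Fenchel defect of `a`. Being also
  -- nonnegative, it vanishes.
  have hcongr : gap H h.pos m p a (hf2.toLp _) =
      -∫ x, (Lagr H (a x) μ + inner ℝ (a x) (p x) + H (p x) μ) ∂(m : Measure Ω) := by
    rw [gap, ← integral_neg]
    refine integral_congr_ae ?_
    filter_upwards [hfcoe] with x hx
    have e1 := hH.Lagr_feedback (p x) μ
    rw [hx, inner_sub_left]
    linarith
  have hnn : ∀ x, 0 ≤ Lagr H (a x) μ + inner ℝ (a x) (p x) + H (p x) μ := fun x => by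
    linarith [hH.neg_le_Lagr_add (a x) (p x) μ]
  have hint : Integrable (fun x => Lagr H (a x) μ + inner ℝ (a x) (p x) + H (p x) μ)
      (m : Measure Ω) := by
    refine (hH.integrable_gap h hpq har hfr μ).congr (Eventually.of_forall fun x => ?_)
    have e1 := hH.Lagr_feedback (p x) μ
    simp only [inner_sub_left]
    linarith
  have hint0 : ∫ x, (Lagr H (a x) μ + inner ℝ (a x) (p x) + H (p x) μ) ∂(m : Measure Ω) = 0 :=
    le_antisymm (by linarith) (integral_nonneg hnn)
  rw [integral_eq_zero_iff_of_nonneg hnn hint] at hint0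
  refine ⟨μ, (coe_controlLaw h.pos har).trans (graphLaw_congr ?_)⟩
  filter_upwards [hint0] with x hx
  refine hH.eq_feedback ?_
  rw [Pi.zero_apply] at hx
  linarith

/-- The dominating function is the feedback bound at the a priori moment `M`. It has growth
‖p‖^(q-1), so it lies in L^r because (q - 1)r = q and `p` is in L^q. -/
theorem exists_fixedPoint (hH : MonotoneHamiltonian H C₀) (h : r.HolderConjugate q)
    (hr2 : 2 ≤ r) (hp : Continuous p)
    (hpq : MemLp p (ENNReal.ofReal q) (m : Measure Ω)) :
    ∃ μ : MomentMeasure Ω r, IsFixedPointLaw H p (m : Measure Ω) μ := by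
  have hC := hH.pos
  obtain ⟨M, hM⟩ : ∃ M, M = 4 * C₀ ^ 2 + r ^ (q - 1) * (2 * C₀) ^ q / q *
    (eLpNorm p (ENNReal.ofReal q) (m : Measure Ω)).toReal ^ q := ⟨_, rfl⟩
  have hM0 : 0 ≤ M := by
    have h1 := h.pos
    have h2 := h.symm.pos
    rw [hM]
    positivity
  have hg0 : ∀ x, 0 ≤ 1 + 2 * C₀ ^ 2 * (1 + M) + C₀ * ‖p x‖ := fun x => by positivity
  have hk0 : ∀ x, 0 ≤ (1 + 2 * C₀ ^ 2 * (1 + M) + C₀ * ‖p x‖) ^ (q - 1) :=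
    fun x => Real.rpow_nonneg (hg0 x) _
  have hgq : MemLp (fun x => 1 + 2 * C₀ ^ 2 * (1 + M) + C₀ * ‖p x‖) (ENNReal.ofReal q)
      (m : Measure Ω) := by
    have e1 : MemLp (fun _ : Ω => 1 + 2 * C₀ ^ 2 * (1 + M)) (ENNReal.ofReal q) (m : Measure Ω) :=
      memLp_const _
    have e2 : MemLp (fun x => C₀ * ‖p x‖) (ENNReal.ofReal q) (m : Measure Ω) :=
      hpq.norm.const_mul C₀
    exact e1.add e2
  refine hH.exists_fixedPoint_of_feedback_le h hr2 hp hpq hk0 ?_ fun x μ hμ =>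
    hH.norm_DpH_le h (p x) μ (hM ▸ hμ)
  rw [memLp_ofReal_iff_integrable_rpow h.pos
    (hgq.1.aemeasurable.pow_const _).aestronglyMeasurable]
  refine (hgq.integrable_rpow h.symm.pos).congr (Eventually.of_forall fun x => ?_)
  have : (q - 1) * r = q := by
    have := h.mul_eq_add
    linarith
  simp only [Real.norm_of_nonneg (hk0 x), Real.norm_of_nonneg (hg0 x), ← Real.rpow_mul (hg0 x),
    this]

end MonotoneHamiltonian

theorem mainTheorem10 {n : ℕ}
    (Ω : Set (Rn n)) (hΩ_open : IsOpen Ω) (hΩ_bdd : Bornology.IsBounded Ω)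
    (hΩ_C2 : HasC2Boundary Ω)
    (d : Rn n → ℝ) (hd : IsRegularizedDistance Ω d)
    (q s C₀ : ℝ) (hq : 1 < q) (hq2 : q ≤ 2) (hs : 0 ≤ s) (hs1 : s < 1) (hC₀ : 0 < C₀)
    (H : Rn n → MomentMeasure Ω (q / (q - 1)) → ℝ)
    (f₁ : MomentMeasure Ω (q / (q - 1)) → ℝ)
    (f₂ : MomentMeasure Ω (q / (q - 1)) → Rn n)
    (f₃ : MomentMeasure Ω (q / (q - 1)) → ℝ)
    (hH : HamiltonianRegular H)
    (hH_growth : HamiltonianGrowth H q s f₁ f₂ f₃)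
    (hL_convex : LagrangianStrictConvex H)
    (hL_mono : LagrangianMonotone H)
    (hL_lower : LagrangianLowerBound H C₀)
    (hL_bound : LagrangianBound H C₀)
    (p : Ω → Rn n) (hp : Continuous p)
    (γ : ℝ) (hγ : 0 < γ)
    (hp_lim : Tendsto (fun x : Ω => ‖p x‖ ^ (q - 1) * d x)
      (comap (fun x : Ω => d x) (𝓝 0)) (𝓝 γ))
    (m : ProbabilityMeasure Ω)
    (hm : ∫⁻ x : Ω, ENNReal.ofReal (d x ^ (-(q / (q - 1)))) ∂(m : Measure Ω) < ∞) :
    MemLp p (ENNReal.ofReal q) (m : Measure Ω) ∧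
    (∀ μ : MomentMeasure Ω (q / (q - 1)), IsFixedPointLaw H p (m : Measure Ω) μ →
      Lam μ ^ (q / (q - 1)) ≤ 4 * C₀ ^ 2 +
        (q / (q - 1)) ^ (q - 1) * (2 * C₀) ^ q / q *
          (eLpNorm p (ENNReal.ofReal q) (m : Measure Ω)).toReal ^ q) ∧
    (∀ μ₁ μ₂ : MomentMeasure Ω (q / (q - 1)), IsFixedPointLaw H p (m : Measure Ω) μ₁ →
      IsFixedPointLaw H p (m : Measure Ω) μ₂ → μ₁ = μ₂) ∧
    (∃! μ : MomentMeasure Ω (q / (q - 1)), IsFixedPointLaw H p (m : Measure Ω) μ) := by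
  have hq1 : 0 < q - 1 := by linarith
  have hconj : (q / (q - 1)).HolderConjugate q := (Real.HolderConjugate.conjExponent hq).symm
  have hr2 : 2 ≤ q / (q - 1) := by
    rw [le_div_iff₀ hq1]
    linarith
  have hMH : MonotoneHamiltonian H C₀ :=
    ⟨hΩ_open.measurableSet, hC₀, hH, hH_growth.lagrBdd hq hs hs1, hL_convex, hL_mono, hL_lower,
      hL_bound⟩
  have hpq : MemLp p (ENNReal.ofReal q) (m : Measure Ω) :=
    memLp_of_tendsto_boundary hd hΩ_open hΩ_bdd hq hp hγ hp_lim hm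
  have huniq := fun μ₁ μ₂ h₁ h₂ =>
    hMH.fixedPoint_unique (m := m) (μ₁ := μ₁) (μ₂ := μ₂) hconj.pos hp h₁ h₂
  obtain ⟨μ, hμ⟩ := hMH.exists_fixedPoint hconj hr2 hp hpq
  exact ⟨hpq, fun μ hμ => hMH.fixedPoint_Lam_rpow_le hconj hp hpq hμ, huniq,
    μ, hμ, fun ν hν => huniq _ _ hν hμ⟩
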